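/- **Energy conservation for the biperiodic elastic grating problem.** Let $\mu>0$, $\lambda+\mu>0$, $\omega>0$, $\kappa_1=\omega/(\lambda+2\mu)^{1/2}$, $\kappa_2=\omega/\mu^{1/2}$. Let $f:\mathbb R^2\to\mathbb R$ be Lipschitz and biperiodic with periods $\Lambda_1,\Lambda_2>0$, let $h>\max f$, and put $r=(x_1,x_2)$, $\Gamma_f=\{x_3=f(r)\}$, $\Omega_f=\{x\in\mathbb R^3: x_3>f(r)\}$. Let $\theta_1\in[0,\pi/2)$, $\theta_2\in[0,2\pi]$, $q=(\sin\theta_1\cos\theta_2,\sin\theta_1\sin\theta_2,-\cos\theta_1)$, let $u^{\rm inc}(x)=q\,e^{i\kappa_1x\cdot q}$ be the incident compressional plane wave, and let $\alpha=\kappa_1(\sin\theta_1\cos\theta_2,\sin\theta_1\sin\theta_2)$, $\beta=\kappa_1\cos\theta_1$. For $n\in\mathbb Z^2$ and $j=1,2$ put $\alpha^{(n)}=(\alpha_1+2\pi n_1/\Lambda_1,\ \alpha_2+2\pi n_2/\Lambda_2)$, and $\beta_j^{(n)}=(\kappa_j^2-|\alpha^{(n)}|^2)^{1/2}$ if $|\alpha^{(n)}|\le\kappa_j$,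 $\beta_j^{(n)}=i(|\alpha^{(n)}|^2-\kappa_j^2)^{1/2}$ otherwise. Assume $\kappa_j\ne|\alpha^{(n)}|$ for all $n\in\mathbb Z^2$ and $j=1,2$. Let $u$ be a total field: $u$ is quasi-biperiodic (that is, $u(x)e^{-i\alpha\cdot r}$ is biperiodic in $(x_1,x_2)$ with periods $\Lambda_1,\Lambda_2$), is of class $H^1$ in every bounded part of $\Omega_f$, is a weak solution of $$\mu\Delta u+(\lambda+\mu)\nabla\nabla\cdot u+\omega^2u=0\ \text{ in }\Omega_f,\qquad u=0\ \text{ on }\Gamma_f,$$ and satisfies the radiation condition that, for $x_3>h$, $u-u^{\rm inc}$ is a convergent superposition over $n\in\mathbb Z^2$ of plane waves $A^{(n)}e^{i(\alpha^{(n)}\cdot r+\beta_1^{(n)}x_3)}+B^{(n)}e^{i(\alpha^{(n)}\cdot r+\beta_2^{(n)}x_3)}$ with $A^{(n)},B^{(n)}\in\mathbb C^3$. Let $\phi^{\rm t},\psi^{\rm t}$ be Helmholtz potentials of $u$, that is, $C^2$ functions on $\Omega_f$, scalar and vector valued, with $$u=\nabla\phi^{\rm t}+\nabla\times\psi^{\rm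 t},\quad \nabla\cdot\psi^{\rm t}=0,\quad \Delta\phi^{\rm t}+\kappa_1^2\phi^{\rm t}=0,\quad \nabla\times(\nabla\times\psi^{\rm t})-\kappa_2^2\psi^{\rm t}=0\quad\text{in }\Omega_f .$$ Put $a_0=-i/\kappa_1$, $\phi^{\rm inc}(x)=a_0e^{i(\alpha\cdot r-\beta x_3)}$ and $\phi=\phi^{\rm t}-\phi^{\rm inc}$. The Rayleigh coefficients are $$a_1^{(n)}=\phi^{(n)}(h)\,e^{-i\beta_1^{(n)}h},\qquad b^{(n)}=(\psi^{\rm t})^{(n)}(h)\,e^{-i\beta_2^{(n)}h},$$ where $F^{(n)}(h)=\frac1{\Lambda_1\Lambda_2}\int_0^{\Lambda_1}\!\int_0^{\Lambda_2}F(r,h)e^{-i\alpha^{(n)}\cdot r}\,dr$, and the efficiencies are $$e_1^{(n)}=\frac{\beta_1^{(n)}|a_1^{(n)}|^2}{\beta|a_0|^2},\qquad e_2^{(n)}=\frac{\beta_2^{(n)}|b^{(n)}|^2}{\beta|a_0|^2}.$$ Then the sets $U_j=\{n\in\mathbb Z^2:|\alpha^{(n)}|\le\kappa_j\}$, $j=1,2$,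 are finite, and $$\sum_{n\in U_1}e_1^{(n)}+\sum_{n\in U_2}e_2^{(n)}=1 .$$ -/

import Mathlib

open MeasureTheory
open scoped ContDiff

noncomputable section

namespace ElasticGrating

/-- Points of `ℝ³`. The norm carried by the function type is never used quantitatively. -/
abbrev Pt : Type := Fin 3 → ℝ

/-- The horizontal part `r = (x₁, x₂)` of a point `x = (x₁, x₂, x₃)`. -/
def horiz (x : Pt) : Fin 2 → ℝ := ![x 0, x 1]

/-! ## Differential operators -/

/-- The partial derivative `∂F/∂x_j`. -/
def pd (j : Fin 3) (F : Pt → ℂ) (x : Pt) : ℂ := fderiv ℝ F x (Pi.single j 1)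

/-- The gradient of a scalar field. -/
def grad (F : Pt → ℂ) (x : Pt) : Fin 3 → ℂ := fun j => pd j F x

/-- The Laplacian of a scalar field. -/
def laplacian (F : Pt → ℂ) (x : Pt) : ℂ := ∑ j, pd j (pd j F) x

/-- The divergence of a vector field. -/
def divergence (F : Pt → Fin 3 → ℂ) (x : Pt) : ℂ := ∑ j, pd j (fun y => F y j) x

/-- The curl of a vector field. -/
def curl (F : Pt → Fin 3 → ℂ) (x : Pt) : Fin 3 → ℂ :=
  ![pd 1 (fun y => F y 2) x - pd 2 (fun y => F y 1) x,
    pd 2 (fun y => F y 0) x - pd 0 (fun y => F y 2) x,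
    pd 0 (fun y => F y 1) x - pd 1 (fun y => F y 0) x]

/-- `g` is the weak partial derivative `∂u/∂x_j` on `ℝ³`. -/
def IsWeakPartial (j : Fin 3) (u g : Pt → ℂ) : Prop :=
  ∀ η : Pt → ℂ, ContDiff ℝ ∞ η → HasCompactSupport η →
    ∫ x, u x * pd j η x = - ∫ x, g x * η x

/-- Local square integrability on `ℝ³`. -/
def IsLocL2 (u : Pt → ℂ) : Prop :=
  ∀ K : Set Pt, IsCompact K → MemLp u 2 (volume.restrict K)

/-! ## The scattering configuration -/

/-- Data of the scattering of a compressional plane wave by a biperiodic rigid surface. -/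
structure Config where
  /-- Lamé constants -/
  lam : ℝ
  mu : ℝ
  mu_pos : 0 < mu
  lam_add_mu_pos : 0 < lam + mu
  /-- angular frequency -/
  omega : ℝ
  omega_pos : 0 < omega
  /-- periods `(Λ₁, Λ₂)` of the surface -/
  period : Fin 2 → ℝ
  period_pos : ∀ k, 0 < period k
  /-- latitudinal and longitudinal incident angles -/
  theta1 : ℝ
  theta2 : ℝ
  theta1_mem : theta1 ∈ Set.Ico 0 (Real.pi / 2)
  theta2_mem : theta2 ∈ Set.Icc 0 (2 * Real.pi)
  /-- the surface is the graph `x₃ = f(r)` of a Lipschitz biperiodic function -/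
  f : (Fin 2 → ℝ) → ℝ
  f_lipschitz : ∃ K, LipschitzWith K f
  f_periodic : ∀ (n : Fin 2 → ℤ) (r : Fin 2 → ℝ), f (fun k => r k + n k * period k) = f r
  /-- a height above the surface -/
  h : ℝ
  f_lt_h : ∀ r, f r < h

namespace Config

variable (P : Config)

/-- Compressional wavenumber `κ₁ = ω / (λ + 2μ)^{1/2}`. -/
def kappa1 : ℝ := P.omega / Real.sqrt (P.lam + 2 * P.mu)

/-- Shear wavenumber `κ₂ = ω / μ^{1/2}`. -/
def kappa2 : ℝ := P.omega / Real.sqrt P.mu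

/-- Direction `q` of propagation of the incident wave. -/
def q : Fin 3 → ℝ :=
  ![Real.sin P.theta1 * Real.cos P.theta2, Real.sin P.theta1 * Real.sin P.theta2,
    - Real.cos P.theta1]

/-- The vector `α = (α₁, α₂)`. -/
def alpha : Fin 2 → ℝ :=
  ![P.kappa1 * Real.sin P.theta1 * Real.cos P.theta2,
    P.kappa1 * Real.sin P.theta1 * Real.sin P.theta2]

/-- `β = κ₁ cos θ₁`. -/
def beta : ℝ := P.kappa1 * Real.cos P.theta1

/-- `α_k^{(n)} = α_k + 2π n_k / Λ_k`, for `n ∈ ℤ²`. -/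
def alphaN (n : Fin 2 → ℤ) (k : Fin 2) : ℝ := P.alpha k + 2 * Real.pi * n k / P.period k

/-- The Euclidean length `|α^{(n)}|`. -/
def alphaAbs (n : Fin 2 → ℤ) : ℝ := Real.sqrt (P.alphaN n 0 ^ 2 + P.alphaN n 1 ^ 2)

/-- `α^{(n)} · r` -/
def alphaDot (n : Fin 2 → ℤ) (r : Fin 2 → ℝ) : ℝ := P.alphaN n 0 * r 0 + P.alphaN n 1 * r 1

/-- The vertical wavenumber `β^{(n)}` belonging to a wavenumber `κ`:
`(κ² - |α^{(n)}|²)^{1/2}` if `|α^{(n)}| ≤ κ` and `i (|α^{(n)}|² - κ²)^{1/2}` otherwise. -/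
def betaN (κ : ℝ) (n : Fin 2 → ℤ) : ℂ :=
  if P.alphaAbs n ≤ κ then (Real.sqrt (κ ^ 2 - P.alphaAbs n ^ 2) : ℂ)
  else Complex.I * (Real.sqrt (P.alphaAbs n ^ 2 - κ ^ 2) : ℂ)

/-- Indices `n` of the propagating modes for a wavenumber `κ`: `|α^{(n)}| ≤ κ`. -/
def propagating (κ : ℝ) : Set (Fin 2 → ℤ) := {n | P.alphaAbs n ≤ κ}

/-- Absence of resonances: `κ_j ≠ |α^{(n)}|` for all `n` and `j = 1, 2`. -/
def NonResonant : Prop := ∀ n, P.kappa1 ≠ P.alphaAbs n ∧ P.kappa2 ≠ P.alphaAbs n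

/-- The domain `Ω_f = {x₃ > f(r)}`. -/
def domain : Set Pt := {x | P.f (horiz x) < x 2}

/-- One period cell of `Ω_f`. -/
def cell : Set Pt :=
  {x | (0 < x 0 ∧ x 0 < P.period 0) ∧ (0 < x 1 ∧ x 1 < P.period 1) ∧ P.f (horiz x) < x 2}

/-- The incident compressional plane wave `u^inc(x) = q exp(i κ₁ x·q)`. -/
def uInc (x : Pt) : Fin 3 → ℂ := fun i =>
  (P.q i : ℂ) * Complex.exp (Complex.I * (P.kappa1 * (∑ j, x j * P.q j) : ℝ))

/-- Quasi-biperiodicity with phase `α`. -/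
def QuasiPeriodic (u : Pt → Fin 3 → ℂ) : Prop :=
  ∀ (n : Fin 2 → ℤ) (x : Pt) (i : Fin 3),
    u ![x 0 + n 0 * P.period 0, x 1 + n 1 * P.period 1, x 2] i =
      Complex.exp (Complex.I *
        (n 0 * P.alpha 0 * P.period 0 + n 1 * P.alpha 1 * P.period 1 : ℝ)) * u x i

/-- `u` is a quasi-biperiodic vector field on `Ω_f`, of class `H¹` on every bounded part of `Ω_f`,
with `u = 0` on the surface `x₃ = f(r)`; `G i j` is the weak derivative `∂u_i/∂x_j`.
The field is extended by zero below the surface. As `f` is Lipschitz, its trace on the surface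
vanishes if and only if this extension is in `H¹_loc(ℝ³)`. -/
structure IsH1Field (u : Pt → Fin 3 → ℂ) (G : Fin 3 → Fin 3 → Pt → ℂ) : Prop where
  quasiPeriodic : P.QuasiPeriodic u
  zero_below : ∀ x, x ∉ P.domain → u x = 0
  locL2 : ∀ i, IsLocL2 (fun x => u x i)
  locL2_grad : ∀ i j, IsLocL2 (G i j)
  weakPartial : ∀ i j, IsWeakPartial j (fun x => u x i) (G i j)

/-- The sesquilinear form of the Navier operator over one period cell of `Ω_f`:
`∫ μ ∇u : ∇w̄ + (λ + μ) (∇·u) (∇·w̄) - ω² u · w̄`, where `G = ∇u` and `W = ∇w`. -/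
def form (u : Pt → Fin 3 → ℂ) (G : Fin 3 → Fin 3 → Pt → ℂ)
    (w : Pt → Fin 3 → ℂ) (W : Fin 3 → Fin 3 → Pt → ℂ) : ℂ :=
  ∫ x in P.cell,
    ((P.mu : ℂ) * (∑ i, ∑ j, G i j x * star (W i j x))
      + ((P.lam + P.mu : ℝ) : ℂ) * ((∑ i, G i i x) * star (∑ i, W i i x))
      - (P.omega ^ 2 : ℝ) * (∑ i, u x i * star (w x i)))

/-- The radiation condition: above height `h`, the diffracted field `u - u^inc` is a superposition
of upward propagating or evanescent (hence bounded) compressional and shear plane waves. -/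
def Radiating (u : Pt → Fin 3 → ℂ) : Prop :=
  ∃ A B : (Fin 2 → ℤ) → Fin 3 → ℂ, ∀ x : Pt, P.h < x 2 → ∀ i,
    HasSum (fun n =>
      A n i * Complex.exp (Complex.I * (P.alphaDot n (horiz x) + P.betaN P.kappa1 n * x 2))
      + B n i * Complex.exp (Complex.I * (P.alphaDot n (horiz x) + P.betaN P.kappa2 n * x 2)))
      (u x i - P.uInc x i)

/-- `u` is the total field of the scattering problem: a quasi-biperiodic field of locally finite
energy with `u = 0` on the surface, solving the Navier equation
`μ Δu + (λ + μ) ∇∇·u + ω² u = 0` weakly in `Ω_f`, and such that `u - u^inc` is radiating.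
The test fields are those of the same class that vanish for large `x₃`. -/
def IsTotalField (u : Pt → Fin 3 → ℂ) : Prop :=
  (∃ G, P.IsH1Field u G ∧
    ∀ w W, P.IsH1Field w W → (∃ H : ℝ, ∀ x, H ≤ x 2 → w x = 0) → P.form u G w W = 0) ∧
  P.Radiating u

/-- `φ` and `ψ` are the Helmholtz potentials of `u` in `Ω_f`: `u = ∇φ + ∇×ψ`, `∇·ψ = 0`,
`Δφ + κ₁² φ = 0` and `∇×(∇×ψ) - κ₂² ψ = 0`. -/
structure IsHelmholtzPair (u : Pt → Fin 3 → ℂ) (φ : Pt → ℂ) (ψ : Pt → Fin 3 → ℂ) : Prop where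
  contDiff_phi : ContDiffOn ℝ 2 φ P.domain
  contDiff_psi : ContDiffOn ℝ 2 ψ P.domain
  decomp : ∀ x ∈ P.domain, u x = grad φ x + curl ψ x
  div_psi : ∀ x ∈ P.domain, divergence ψ x = 0
  helmholtz : ∀ x ∈ P.domain, laplacian φ x + (P.kappa1 ^ 2 : ℝ) * φ x = 0
  maxwell : ∀ x ∈ P.domain, ∀ i, curl (curl ψ) x i - (P.kappa2 ^ 2 : ℝ) * ψ x i = 0

/-- The Fourier coefficient
`F^{(n)}(h) = (Λ₁ Λ₂)⁻¹ ∫₀^{Λ₁} ∫₀^{Λ₂} F(r, h) exp(-i α^{(n)}·r) dr`. -/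
def fourierCoeffH (F : Pt → ℂ) (n : Fin 2 → ℤ) : ℂ :=
  1 / (P.period 0 * P.period 1 : ℝ) *
    ∫ x₁ in (0 : ℝ)..P.period 0, ∫ x₂ in (0 : ℝ)..P.period 1,
      F ![x₁, x₂, P.h] * Complex.exp (-Complex.I * P.alphaDot n ![x₁, x₂])

/-- `a₀ = -i/κ₁`, the amplitude of the incident potential. -/
def a0 : ℂ := -Complex.I / P.kappa1

/-- The incident scalar potential `φ^inc = a₀ exp(i(α·r - β x₃))`. -/
def phiInc (x : Pt) : ℂ :=
  P.a0 * Complex.exp (Complex.I * (P.alpha 0 * x 0 + P.alpha 1 * x 1 - P.beta * x 2 : ℝ))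

/-- The Rayleigh coefficient `a₁^{(n)}` of the total scalar potential `φ^t`: with `φ = φ^t - φ^inc`
it is `φ^{(n)}(h) exp(-i β₁^{(n)} h)`. -/
def a1 (φt : Pt → ℂ) (n : Fin 2 → ℤ) : ℂ :=
  P.fourierCoeffH (fun x => φt x - P.phiInc x) n *
    Complex.exp (-Complex.I * P.betaN P.kappa1 n * P.h)

/-- The Rayleigh coefficient `b^{(n)} = ψ^{(n)}(h) exp(-i β₂^{(n)} h)` of the vector potential
(the incident vector potential is zero). -/
def b (ψt : Pt → Fin 3 → ℂ) (n : Fin 2 → ℤ) : Fin 3 → ℂ := fun i =>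
  P.fourierCoeffH (fun x => ψt x i) n * Complex.exp (-Complex.I * P.betaN P.kappa2 n * P.h)

/-- Efficiency `e₁^{(n)} = β₁^{(n)} |a₁^{(n)}|² / (β |a₀|²)` of a compressional mode. -/
def e1 (φt : Pt → ℂ) (n : Fin 2 → ℤ) : ℂ :=
  P.betaN P.kappa1 n * (‖P.a1 φt n‖ ^ 2 : ℝ) / (P.beta * ‖P.a0‖ ^ 2 : ℝ)

/-- Efficiency `e₂^{(n)} = β₂^{(n)} |b^{(n)}|² / (β |a₀|²)` of a shear mode. -/
def e2 (ψt : Pt → Fin 3 → ℂ) (n : Fin 2 → ℤ) : ℂ :=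
  P.betaN P.kappa2 n * (∑ i, ‖P.b ψt n i‖ ^ 2 : ℝ) / (P.beta * ‖P.a0‖ ^ 2 : ℝ)

end Config

end ElasticGrating

end

/-!
Energy conservation for the biperiodic elastic grating problem.

The equation for `u` has real coefficients and no absorption, so the imaginary part of the energy
flux of `u` through one period of a horizontal plane above the surface is the same for every plane,
and it is zero because `u` vanishes on the surface. Expressing the flux through the Rayleigh
coefficients turns this into the assertion.

*The flux vanishes.* The test field `χ(x₃) u`, with a cut-off `χ` equal to `1` up to a height above
`h`, is admissible in the weak formulation (`isH1Field_cutoff`). The volume terms are real, so the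
imaginary part of the tested equation is the integral of `χ'(x₃)` times the flux density
(`integral_cell_flux_eq_zero`), in which only the region above `h` counts. There `u = ∇φ + ∇×ψ` is
continuously differentiable, and its weak gradient is the classical one almost everywhere
(`IsWeakPartial.ae_eq_pd`). Once the flux through the plane of height `t` is known to be independent
of `t`, it must therefore be zero (`flux_eq_zero`).

*The modes.* The radiation series converges unconditionally at every point, so its coefficients are
absolutely summable in every horizontal plane; term by term integration gives the Fourier
coefficients of `u` and a Parseval relation (`integral_mul_star_wave`, `hasSum_integral_mul_star`).
Differentiating a quasi-biperiodic function multiplies the amplitudes of its modes by `i` times the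
wave vector (`HasModes.pd`). Since `∇·u = -κ₁² φ` and `∇×u = κ₂² ψ`, the potentials are
quasi-biperiodic with known modes, and the relation `u = ∇φ + ∇×ψ` forces the amplitudes `A^{(n)}`
to be parallel, and `B^{(n)}` to be orthogonal, to their wave vectors (`polarized`).

*The flux of a mode.* For polarized amplitudes the interactions between the downward compressional,
the upward compressional and the upward shear wave of one mode cancel (`flux_identity`), and
evanescent waves carry no flux. The flux of a mode is thus independent of the height and given by
the Rayleigh coefficients (`im_flux_mode`, `norm_a1`, `mu_mul_re_betaN`). Summing over the modes
yields the balance of energy (`hasSum_energy`), which has only finitely many nonzero terms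
(`finite_propagating`).
-/

noncomputable section

open Filter Topology

namespace ElasticGrating

/-! ### Calculus of partial derivatives -/

section Calculus

variable {F G : Pt → ℂ} {x : Pt} {s : Set Pt}

theorem pd_congr (j : Fin 3) (h : F =ᶠ[𝓝 x] G) : pd j F x = pd j G x := by
  simp only [pd, h.fderiv_eq]

theorem pd_congr_of_eqOn (j : Fin 3) (hs : IsOpen s) (hx : x ∈ s) (h : ∀ y ∈ s, F y = G y) :
    pd j F x = pd j G x :=
  pd_congr j (Filter.eventuallyEq_of_mem (hs.mem_nhds hx) h)

theorem pd_add (j : Fin 3) (hF : DifferentiableAt ℝ F x) (hG : DifferentiableAt ℝ G x) :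
    pd j (fun y => F y + G y) x = pd j F x + pd j G x := by
  simp only [pd, fderiv_fun_add hF hG, add_apply]

theorem pd_sub (j : Fin 3) (hF : DifferentiableAt ℝ F x) (hG : DifferentiableAt ℝ G x) :
    pd j (fun y => F y - G y) x = pd j F x - pd j G x := by
  simp only [pd, fderiv_fun_sub hF hG, sub_apply]

theorem pd_mul (j : Fin 3) (hF : DifferentiableAt ℝ F x) (hG : DifferentiableAt ℝ G x) :
    pd j (fun y => F y * G y) x = F x * pd j G x + pd j F x * G x := by
  simp only [pd, fderiv_fun_mul hF hG, add_apply,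
    smul_apply, smul_eq_mul]
  ring

theorem contDiffOn_pd (j : Fin 3) (hs : IsOpen s) {m n : WithTop ℕ∞} (hmn : m + 1 ≤ n)
    (hF : ContDiffOn ℝ n F s) : ContDiffOn ℝ m (pd j F) s :=
  (hF.fderiv_of_isOpen hs hmn).clm_apply contDiffOn_const

/-- Mixed second partial derivatives commute. -/
theorem pd_comm (i j : Fin 3) (hF : ContDiffAt ℝ 2 F x) :
    pd i (pd j F) x = pd j (pd i F) x := by
  have hd : DifferentiableAt ℝ (fderiv ℝ F) x :=
    (hF.fderiv_right (m := 1) (by norm_num)).differentiableAt (by norm_num)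
  have key : ∀ i j : Fin 3, pd i (pd j F) x
      = fderiv ℝ (fderiv ℝ F) x (Pi.single i 1) (Pi.single j 1) := by
    intro i j
    have : pd j F = fun y => (fderiv ℝ F y) (Pi.single j 1) := rfl
    rw [this]
    simp only [pd]
    rw [fderiv_clm_apply hd (differentiableAt_const _)]
    simp
  rw [key, key]
  exact (hF.isSymmSndFDerivAt (by simp)).eq _ _

/-- Restricted to a line parallel to a coordinate axis, `F` has derivative `pd j F`. -/
theorem hasDerivAt_line (j : Fin 3) {γ : ℝ → Pt} {t : ℝ}
    (hγ : HasDerivAt γ (Pi.single j 1) t) (hF : DifferentiableAt ℝ F (γ t)) :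
    HasDerivAt (fun τ => F (γ τ)) (pd j F (γ t)) t :=
  hF.hasFDerivAt.comp_hasDerivAt t hγ

theorem pd_comp_add (j : Fin 3) (v : Pt) : pd j (fun y => F (y + v)) x = pd j F (x + v) := by
  simp only [pd, fderiv_comp_add_right]

theorem hasDerivAt_vec_zero (a b t : ℝ) :
    HasDerivAt (fun τ : ℝ => (![τ, a, b] : Pt)) (Pi.single 0 1) t := by
  rw [hasDerivAt_pi]
  intro i; fin_cases i <;> simp [hasDerivAt_id', hasDerivAt_const]

theorem hasDerivAt_vec_one (a b t : ℝ) :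
    HasDerivAt (fun τ : ℝ => (![a, τ, b] : Pt)) (Pi.single 1 1) t := by
  rw [hasDerivAt_pi]
  intro i; fin_cases i <;> simp [hasDerivAt_id', hasDerivAt_const]

theorem hasDerivAt_vec_two (a b t : ℝ) :
    HasDerivAt (fun τ : ℝ => (![a, b, τ] : Pt)) (Pi.single 2 1) t := by
  rw [hasDerivAt_pi]
  intro i; fin_cases i <;> simp [hasDerivAt_id', hasDerivAt_const]

end Calculus

/-! ### The half-space above a height and the periodic structure -/

/-- The half-space `x₃ > c`. -/
def above (c : ℝ) : Set Pt := {x | c < x 2}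

theorem isOpen_above (c : ℝ) : IsOpen (above c) :=
  isOpen_lt continuous_const (continuous_apply 2)

namespace Config

variable (P : Config)

/-- The horizontal lattice vector `(n₁Λ₁, n₂Λ₂, 0)`. -/
def latticeVec (n : Fin 2 → ℤ) : Pt := ![n 0 * P.period 0, n 1 * P.period 1, 0]

/-- The phase acquired by a quasi-biperiodic field under translation by a lattice vector. -/
def phase (n : Fin 2 → ℤ) : ℂ :=
  Complex.exp (Complex.I * (n 0 * P.alpha 0 * P.period 0 + n 1 * P.alpha 1 * P.period 1 : ℝ))

/-- Quasi-biperiodicity of a scalar field on the half-space `x₃ > c`. -/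
def QPOn (c : ℝ) (F : Pt → ℂ) : Prop :=
  ∀ n, ∀ x ∈ above c, F (x + P.latticeVec n) = P.phase n * F x

variable {P}

theorem add_latticeVec (n : Fin 2 → ℤ) (x : Pt) :
    x + P.latticeVec n = ![x 0 + n 0 * P.period 0, x 1 + n 1 * P.period 1, x 2] := by
  ext i; fin_cases i <;> simp [latticeVec]

theorem add_latticeVec_mem_above {c : ℝ} {n : Fin 2 → ℤ} {x : Pt} (hx : x ∈ above c) :
    x + P.latticeVec n ∈ above c := by
  rw [add_latticeVec]; exact hx

theorem QPOn.congr {c : ℝ} {F G : Pt → ℂ} (hF : P.QPOn c F) (h : ∀ x ∈ above c, G x = F x) :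
    P.QPOn c G := by
  intro n x hx
  rw [h x hx, h _ (add_latticeVec_mem_above hx), hF n x hx]

theorem QPOn.const_mul {c : ℝ} {F : Pt → ℂ} (hF : P.QPOn c F) (a : ℂ) :
    P.QPOn c (fun x => a * F x) := by
  intro n x hx
  simp only [hF n x hx]; ring

theorem QPOn.add {c : ℝ} {F G : Pt → ℂ} (hF : P.QPOn c F) (hG : P.QPOn c G) :
    P.QPOn c (fun x => F x + G x) := by
  intro n x hx
  simp only [hF n x hx, hG n x hx]; ring

theorem QPOn.sub {c : ℝ} {F G : Pt → ℂ} (hF : P.QPOn c F) (hG : P.QPOn c G) :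
    P.QPOn c (fun x => F x - G x) := by
  intro n x hx
  simp only [hF n x hx, hG n x hx]; ring

theorem QPOn.pd {c : ℝ} {F : Pt → ℂ} (hF : P.QPOn c F) (hd : DifferentiableOn ℝ F (above c))
    (j : Fin 3) : P.QPOn c (pd j F) := by
  intro n x hx
  rw [← pd_comp_add, pd_congr_of_eqOn j (isOpen_above c) hx (hF n)]
  simp only [ElasticGrating.pd]
  rw [fderiv_const_mul (hd.differentiableAt ((isOpen_above c).mem_nhds hx))]
  simp

theorem isOpen_domain : IsOpen P.domain := by
  obtain ⟨K, hK⟩ := P.f_lipschitz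
  refine isOpen_lt (hK.continuous.comp ?_) (continuous_apply 2)
  exact continuous_pi fun i => by
    fin_cases i
    · exact continuous_apply (0 : Fin 3)
    · exact continuous_apply (1 : Fin 3)

/-- The surface lies below some height `h₀ < h`: a continuous periodic function attains its
maximum. -/
theorem exists_lt_h : ∃ h₀ < P.h, above h₀ ⊆ P.domain := by
  obtain ⟨K, hK⟩ := P.f_lipschitz
  have hc : IsCompact (Set.Icc (0 : Fin 2 → ℝ) P.period) := isCompact_Icc
  have hp := P.period_pos
  obtain ⟨r₀, -, hr₀⟩ :=
    hc.exists_isMaxOn ⟨0, le_rfl, fun k => (hp k).le⟩ hK.continuous.continuousOn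
  refine ⟨P.f r₀, P.f_lt_h r₀, fun x hx => ?_⟩
  refine lt_of_le_of_lt ?_ (show P.f r₀ < x 2 from hx)
  set n : Fin 2 → ℤ := fun k => -⌊horiz x k / P.period k⌋
  rw [← P.f_periodic n (horiz x)]
  refine hr₀ ⟨fun k => ?_, fun k => ?_⟩
  · have := Int.floor_le (horiz x k / P.period k)
    rw [le_div_iff₀ (hp k)] at this
    simp only [n, Pi.zero_apply]; push_cast; linarith
  · have := (Int.lt_floor_add_one (horiz x k / P.period k)).le
    rw [div_le_iff₀ (hp k)] at this
    simp only [n]; push_cast; linarith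

end Config

/-! ### Consequences of the Helmholtz decomposition -/

namespace Config.IsHelmholtzPair

variable {P : Config} {u : Pt → Fin 3 → ℂ} {φ : Pt → ℂ} {ψ : Pt → Fin 3 → ℂ}

theorem contDiffOn_psi_apply (hp : P.IsHelmholtzPair u φ ψ) (i : Fin 3) :
    ContDiffOn ℝ 2 (fun x => ψ x i) P.domain := contDiffOn_pi.1 hp.contDiff_psi i

theorem contDiffOn_pd_phi (hp : P.IsHelmholtzPair u φ ψ) (j : Fin 3) :
    ContDiffOn ℝ 1 (pd j φ) P.domain :=
  contDiffOn_pd j isOpen_domain (by norm_num) hp.contDiff_phi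

theorem contDiffOn_pd_psi (hp : P.IsHelmholtzPair u φ ψ) (i j : Fin 3) :
    ContDiffOn ℝ 1 (pd j (fun x => ψ x i)) P.domain :=
  contDiffOn_pd j isOpen_domain (by norm_num) (hp.contDiffOn_psi_apply i)

theorem contDiffOn_curl (hp : P.IsHelmholtzPair u φ ψ) (i : Fin 3) :
    ContDiffOn ℝ 1 (fun x => curl ψ x i) P.domain := by
  fin_cases i
  · exact (hp.contDiffOn_pd_psi 2 1).sub (hp.contDiffOn_pd_psi 1 2)
  · exact (hp.contDiffOn_pd_psi 0 2).sub (hp.contDiffOn_pd_psi 2 0)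
  · exact (hp.contDiffOn_pd_psi 1 0).sub (hp.contDiffOn_pd_psi 0 1)

theorem contDiffOn_u (hp : P.IsHelmholtzPair u φ ψ) (i : Fin 3) :
    ContDiffOn ℝ 1 (fun x => u x i) P.domain :=
  ((hp.contDiffOn_pd_phi i).add (hp.contDiffOn_curl i)).congr fun x hx => by
    rw [hp.decomp x hx]; rfl

theorem pd_u (hp : P.IsHelmholtzPair u φ ψ) (i j : Fin 3) {x : Pt} (hx : x ∈ P.domain) :
    pd j (fun y => u y i) x = pd j (pd i φ) x + pd j (fun y => curl ψ y i) x := by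
  have hn := isOpen_domain.mem_nhds hx
  rw [pd_congr_of_eqOn (G := fun y => pd i φ y + curl ψ y i) j isOpen_domain hx
    (fun y hy => by rw [hp.decomp y hy]; rfl)]
  exact pd_add j (((hp.contDiffOn_pd_phi i).contDiffAt hn).differentiableAt (by norm_num))
    (((hp.contDiffOn_curl i).contDiffAt hn).differentiableAt (by norm_num))

/-- The scalar potential is recovered from the divergence of the field. -/
theorem divergence_u (hp : P.IsHelmholtzPair u φ ψ) {x : Pt} (hx : x ∈ P.domain) :
    divergence u x = -(P.kappa1 ^ 2 : ℝ) * φ x := by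
  have hn := isOpen_domain.mem_nhds hx
  have hd : ∀ i j, DifferentiableAt ℝ (pd j (fun y => ψ y i)) x := fun i j =>
    ((hp.contDiffOn_pd_psi i j).contDiffAt hn).differentiableAt (by norm_num)
  have hc : ∀ i j k, pd j (pd k (fun y => ψ y i)) x = pd k (pd j (fun y => ψ y i)) x := fun i j k =>
    pd_comm j k ((hp.contDiffOn_psi_apply i).contDiffAt hn)
  have h0 : pd 0 (fun y => curl ψ y 0) x
      = pd 0 (pd 1 (fun y => ψ y 2)) x - pd 0 (pd 2 (fun y => ψ y 1)) x :=
    pd_sub 0 (hd _ _) (hd _ _)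
  have h1 : pd 1 (fun y => curl ψ y 1) x
      = pd 1 (pd 2 (fun y => ψ y 0)) x - pd 1 (pd 0 (fun y => ψ y 2)) x :=
    pd_sub 1 (hd _ _) (hd _ _)
  have h2 : pd 2 (fun y => curl ψ y 2) x
      = pd 2 (pd 0 (fun y => ψ y 1)) x - pd 2 (pd 1 (fun y => ψ y 0)) x :=
    pd_sub 2 (hd _ _) (hd _ _)
  have hl := hp.helmholtz x hx
  simp only [laplacian, Fin.sum_univ_three] at hl
  simp only [divergence, Fin.sum_univ_three, hp.pd_u _ _ hx, h0, h1, h2]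
  rw [hc 2 0 1, hc 1 0 2, hc 0 1 2]
  linear_combination hl

/-- The vector potential is recovered from the curl of the field. -/
theorem curl_u (hp : P.IsHelmholtzPair u φ ψ) {x : Pt} (hx : x ∈ P.domain) (i : Fin 3) :
    curl u x i = (P.kappa2 ^ 2 : ℝ) * ψ x i := by
  have hn := isOpen_domain.mem_nhds hx
  have hc : ∀ j k, pd j (pd k φ) x = pd k (pd j φ) x := fun j k =>
    pd_comm j k (hp.contDiff_phi.contDiffAt hn)
  have hm := hp.maxwell x hx i
  fin_cases i
  · simp only [curl, hp.pd_u _ _ hx, Fin.zero_eta, Matrix.cons_val_zero] at hm ⊢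
    linear_combination hm + hc 1 2
  · simp only [curl, hp.pd_u _ _ hx, Fin.mk_one, Matrix.cons_val_one, Matrix.cons_val_zero] at hm ⊢
    linear_combination hm + hc 2 0
  · simp only [curl, hp.pd_u _ _ hx, Fin.reduceFinMk, Matrix.cons_val] at hm ⊢
    linear_combination hm + hc 0 1

end Config.IsHelmholtzPair

/-! ### Fourier coefficients on horizontal cross-sections -/

/-- The point of height `t` above `p`. -/
def point (p : ℝ × ℝ) (t : ℝ) : Pt := ![p.1, p.2, t]

theorem continuous_point : Continuous (fun z : (ℝ × ℝ) × ℝ => point z.1 z.2) := by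
  refine continuous_pi fun i => ?_
  fin_cases i
  · exact continuous_fst.fst
  · exact continuous_fst.snd
  · exact continuous_snd

theorem continuous_comp_point {F : Pt → ℂ} {c t : ℝ} (hF : ContinuousOn F (above c)) (ht : c < t) :
    Continuous fun p => F (point p t) :=
  hF.comp_continuous (continuous_point.comp (Continuous.prodMk_left t)) fun _ => ht

namespace Config

variable (P : Config)

/-- One period of the horizontal plane. -/
def box : Set (ℝ × ℝ) := Set.Ioc 0 (P.period 0) ×ˢ Set.Ioc 0 (P.period 1)

/-- The horizontal plane wave `exp(i α^{(n)}·r)`. -/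
def wave (n : Fin 2 → ℤ) (p : ℝ × ℝ) : ℂ :=
  Complex.exp (Complex.I * (P.alphaN n 0 * p.1 + P.alphaN n 1 * p.2 : ℝ))

/-- The Fourier coefficient of `F` at height `t`, without the normalizing factor `1 / (Λ₁ Λ₂)`. -/
def coef (F : Pt → ℂ) (n : Fin 2 → ℤ) (t : ℝ) : ℂ :=
  ∫ p in P.box, F (point p t) * star (P.wave n p)

variable {P}

theorem measurableSet_box : MeasurableSet P.box := measurableSet_Ioc.prod measurableSet_Ioc

theorem box_subset : P.box ⊆ Set.Icc 0 (P.period 0) ×ˢ Set.Icc 0 (P.period 1) :=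
  Set.prod_mono Set.Ioc_subset_Icc_self Set.Ioc_subset_Icc_self

theorem isCompact_closedBox : IsCompact (Set.Icc 0 (P.period 0) ×ˢ Set.Icc 0 (P.period 1)) :=
  isCompact_Icc.prod isCompact_Icc

theorem volume_box_lt_top : volume P.box < ⊤ :=
  (measure_mono box_subset).trans_lt isCompact_closedBox.measure_lt_top

theorem integrableOn_box {g : ℝ × ℝ → ℂ} (hg : Continuous g) : IntegrableOn g P.box :=
  (hg.continuousOn.integrableOn_compact isCompact_closedBox).mono_set box_subset

theorem continuous_wave (n : Fin 2 → ℤ) : Continuous (P.wave n) := by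
  unfold wave; fun_prop

theorem norm_wave (n : Fin 2 → ℤ) (p : ℝ × ℝ) : ‖P.wave n p‖ = 1 := by
  rw [wave, mul_comm, Complex.norm_exp_ofReal_mul_I]

theorem star_wave (n : Fin 2 → ℤ) (p : ℝ × ℝ) :
    star (P.wave n p) = Complex.exp (-Complex.I * P.alphaDot n ![p.1, p.2]) := by
  simp only [wave, alphaDot, Complex.star_def, ← Complex.exp_conj]
  simp

theorem continuous_star_wave (n : Fin 2 → ℤ) : Continuous fun p => star (P.wave n p) :=
  (continuous_wave n).star

theorem integrableOn_coef {F : Pt → ℂ} {c t : ℝ} (hF : ContinuousOn F (above c)) (ht : c < t)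
    (n : Fin 2 → ℤ) : IntegrableOn (fun p => F (point p t) * star (P.wave n p)) P.box :=
  integrableOn_box ((continuous_comp_point hF ht).mul (continuous_star_wave n))

theorem coef_congr {F G : Pt → ℂ} {c t : ℝ} (ht : c < t) (h : ∀ x ∈ above c, F x = G x)
    (n : Fin 2 → ℤ) : P.coef F n t = P.coef G n t := by
  unfold coef
  congr 1; ext p
  rw [h (point p t) ht]

theorem coef_add {F G : Pt → ℂ} {c t : ℝ} (hF : ContinuousOn F (above c))
    (hG : ContinuousOn G (above c)) (ht : c < t) (n : Fin 2 → ℤ) :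
    P.coef (fun x => F x + G x) n t = P.coef F n t + P.coef G n t := by
  simp only [coef, add_mul]
  exact integral_add (integrableOn_coef hF ht n) (integrableOn_coef hG ht n)

theorem coef_sub {F G : Pt → ℂ} {c t : ℝ} (hF : ContinuousOn F (above c))
    (hG : ContinuousOn G (above c)) (ht : c < t) (n : Fin 2 → ℤ) :
    P.coef (fun x => F x - G x) n t = P.coef F n t - P.coef G n t := by
  simp only [coef, sub_mul]
  exact integral_sub (integrableOn_coef hF ht n) (integrableOn_coef hG ht n)

theorem coef_const_mul (F : Pt → ℂ) (a : ℂ) (n : Fin 2 → ℤ) (t : ℝ) :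
    P.coef (fun x => a * F x) n t = a * P.coef F n t := by
  simp only [coef, mul_assoc]
  exact integral_const_mul _ _

theorem fourierCoeffH_eq {F : Pt → ℂ} {c : ℝ} (hF : ContinuousOn F (above c)) (hc : c < P.h)
    (n : Fin 2 → ℤ) :
    P.fourierCoeffH F n = 1 / (P.period 0 * P.period 1 : ℝ) * P.coef F n P.h := by
  unfold fourierCoeffH coef box
  rw [Measure.volume_eq_prod, setIntegral_prod _ (integrableOn_coef hF hc n),
    intervalIntegral.integral_of_le (P.period_pos 0).le]
  congr 1
  refine integral_congr_ae (ae_of_all _ fun x => ?_)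
  simp only [intervalIntegral.integral_of_le (P.period_pos 1).le, star_wave]
  rfl

/-- A continuous derivative in the first variable of a function that takes the same values on the
two opposite sides has zero mean over the period. -/
theorem integral_box_deriv_fst {g g' : ℝ × ℝ → ℂ} (hg' : Continuous g')
    (hd : ∀ x y, HasDerivAt (fun s => g (s, y)) (g' (x, y)) x)
    (hper : ∀ y, g (P.period 0, y) = g (0, y)) : ∫ p in P.box, g' p = 0 := by
  have hi : IntegrableOn g' P.box := integrableOn_box hg'
  unfold IntegrableOn at hi
  rw [box, Measure.volume_eq_prod, ← Measure.prod_restrict] at hi ⊢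
  rw [integral_prod_symm _ hi]
  refine integral_eq_zero_of_ae (ae_of_all _ fun y => ?_)
  simp only [← intervalIntegral.integral_of_le (P.period_pos 0).le]
  rw [intervalIntegral.integral_eq_sub_of_hasDerivAt (f := fun s => g (s, y))
    (fun x _ => hd x y) ((hg'.comp (Continuous.prodMk_left y)).intervalIntegrable _ _), hper]
  simp

theorem integral_box_deriv_snd {g g' : ℝ × ℝ → ℂ} (hg' : Continuous g')
    (hd : ∀ x y, HasDerivAt (fun s => g (x, s)) (g' (x, y)) y)
    (hper : ∀ x, g (x, P.period 1) = g (x, 0)) : ∫ p in P.box, g' p = 0 := by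
  have hi : IntegrableOn g' P.box := integrableOn_box hg'
  unfold IntegrableOn at hi
  rw [box, Measure.volume_eq_prod, ← Measure.prod_restrict] at hi ⊢
  rw [integral_prod _ hi]
  refine integral_eq_zero_of_ae (ae_of_all _ fun x => ?_)
  simp only [← intervalIntegral.integral_of_le (P.period_pos 1).le]
  rw [intervalIntegral.integral_eq_sub_of_hasDerivAt (f := fun s => g (x, s))
    (fun y _ => hd x y) ((hg'.comp (Continuous.prodMk_right x)).intervalIntegrable _ _), hper]
  simp

theorem phase_mul_star_wave_fst (n : Fin 2 → ℤ) (y : ℝ) :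
    P.phase ![1, 0] * star (P.wave n (P.period 0, y)) = star (P.wave n (0, y)) := by
  simp only [phase, star_wave, ← Complex.exp_add, alphaDot, alphaN]
  rw [Complex.exp_eq_exp_iff_exists_int]
  -- the phase of the mode exceeds that of the lattice translation by a multiple of `2π`
  refine ⟨-n 0, ?_⟩
  have : (P.period 0 : ℂ) ≠ 0 := by exact_mod_cast (P.period_pos 0).ne'
  simp
  field_simp
  ring

theorem phase_mul_star_wave_snd (n : Fin 2 → ℤ) (x : ℝ) :
    P.phase ![0, 1] * star (P.wave n (x, P.period 1)) = star (P.wave n (x, 0)) := by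
  simp only [phase, star_wave, ← Complex.exp_add, alphaDot, alphaN]
  rw [Complex.exp_eq_exp_iff_exists_int]
  refine ⟨-n 1, ?_⟩
  have : (P.period 1 : ℂ) ≠ 0 := by exact_mod_cast (P.period_pos 1).ne'
  simp
  field_simp
  ring

theorem hasDerivAt_star_wave_fst (n : Fin 2 → ℤ) (x y : ℝ) :
    HasDerivAt (fun s => star (P.wave n (s, y)))
      (-Complex.I * P.alphaN n 0 * star (P.wave n (x, y))) x := by
  simp only [star_wave, alphaDot]
  have h : HasDerivAt (fun s : ℝ => -Complex.I * ((P.alphaN n 0 * s + P.alphaN n 1 * y : ℝ) : ℂ))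
      (-Complex.I * ((P.alphaN n 0 * 1 : ℝ) : ℂ)) x :=
    ((((hasDerivAt_id' x).const_mul (P.alphaN n 0)).add_const _).ofReal_comp).const_mul _
  refine h.cexp.congr_deriv ?_
  simp; ring

theorem hasDerivAt_star_wave_snd (n : Fin 2 → ℤ) (x y : ℝ) :
    HasDerivAt (fun s => star (P.wave n (x, s)))
      (-Complex.I * P.alphaN n 1 * star (P.wave n (x, y))) y := by
  simp only [star_wave, alphaDot]
  have h : HasDerivAt (fun s : ℝ => -Complex.I * ((P.alphaN n 0 * x + P.alphaN n 1 * s : ℝ) : ℂ))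
      (-Complex.I * ((P.alphaN n 1 * 1 : ℝ) : ℂ)) y :=
    ((((hasDerivAt_id' y).const_mul (P.alphaN n 1)).const_add _).ofReal_comp).const_mul _
  refine h.cexp.congr_deriv ?_
  simp; ring

section Derivatives

variable {F : Pt → ℂ} {c t : ℝ}

theorem continuousOn_pd_above (hF : ContDiffOn ℝ 1 F (above c)) (j : Fin 3) :
    ContinuousOn (pd j F) (above c) :=
  (contDiffOn_pd (m := 0) j (isOpen_above c) (by norm_num) hF).continuousOn

theorem differentiableAt_above (hF : ContDiffOn ℝ 1 F (above c)) {x : Pt} (hx : x ∈ above c) :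
    DifferentiableAt ℝ F x :=
  (hF.contDiffAt ((isOpen_above c).mem_nhds hx)).differentiableAt (by norm_num)

/-- Integration by parts over the period: the boundary terms cancel, since `F` and `wave n` acquire
the same phase under translation by a period. -/
theorem coef_pd_zero (hF : ContDiffOn ℝ 1 F (above c)) (hq : P.QPOn c F) (ht : c < t)
    (n : Fin 2 → ℤ) :
    P.coef (pd 0 F) n t = Complex.I * P.alphaN n 0 * P.coef F n t := by
  have hc' := continuous_comp_point (continuousOn_pd_above hF 0) ht
  have hc := continuous_comp_point hF.continuousOn ht
  have h := integral_box_deriv_fst (P := P) (g := fun p => F (point p t) * star (P.wave n p))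
    (g' := fun p => pd 0 F (point p t) * star (P.wave n p)
      + F (point p t) * (-Complex.I * P.alphaN n 0 * star (P.wave n p)))
    ((hc'.mul (continuous_star_wave n)).add
      (hc.mul (continuous_const.mul (continuous_star_wave n))))
    (fun x y => (hasDerivAt_line 0 (hasDerivAt_vec_zero y t x)
      (differentiableAt_above hF (x := point (x, y) t) ht)).mul (hasDerivAt_star_wave_fst n x y))
    (fun y => by
      have := hq ![1, 0] (point (0, y) t) ht
      rw [add_latticeVec] at this
      simp only [point, Matrix.cons_val] at this ⊢
      simp only [Int.cast_one, Int.cast_zero, zero_mul, one_mul, zero_add, add_zero] at this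
      rw [this, ← phase_mul_star_wave_fst]
      ring)
  simp only [mul_left_comm (F _)] at h
  rw [integral_add (integrableOn_coef (continuousOn_pd_above hF 0) ht n)
    ((integrableOn_coef hF.continuousOn ht n).const_mul _), integral_const_mul] at h
  unfold coef
  linear_combination h

theorem coef_pd_one (hF : ContDiffOn ℝ 1 F (above c)) (hq : P.QPOn c F) (ht : c < t)
    (n : Fin 2 → ℤ) :
    P.coef (pd 1 F) n t = Complex.I * P.alphaN n 1 * P.coef F n t := by
  have hc' := continuous_comp_point (continuousOn_pd_above hF 1) ht
  have hc := continuous_comp_point hF.continuousOn ht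
  have h := integral_box_deriv_snd (P := P) (g := fun p => F (point p t) * star (P.wave n p))
    (g' := fun p => pd 1 F (point p t) * star (P.wave n p)
      + F (point p t) * (-Complex.I * P.alphaN n 1 * star (P.wave n p)))
    ((hc'.mul (continuous_star_wave n)).add
      (hc.mul (continuous_const.mul (continuous_star_wave n))))
    (fun x y => (hasDerivAt_line 1 (hasDerivAt_vec_one x t y)
      (differentiableAt_above hF (x := point (x, y) t) ht)).mul (hasDerivAt_star_wave_snd n x y))
    (fun x => by
      have := hq ![0, 1] (point (x, 0) t) ht
      rw [add_latticeVec] at this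
      simp only [point, Matrix.cons_val] at this ⊢
      simp only [Int.cast_one, Int.cast_zero, zero_mul, one_mul, zero_add, add_zero] at this
      rw [this, ← phase_mul_star_wave_snd]
      ring)
  simp only [mul_left_comm (F _)] at h
  rw [integral_add (integrableOn_coef (continuousOn_pd_above hF 1) ht n)
    ((integrableOn_coef hF.continuousOn ht n).const_mul _), integral_const_mul] at h
  unfold coef
  linear_combination h

/-- Differentiation under the integral sign, on a compact range of heights. -/
theorem hasDerivAt_coef (hF : ContDiffOn ℝ 1 F (above c)) (ht : c < t) (n : Fin 2 → ℤ) :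
    HasDerivAt (P.coef F n) (P.coef (pd 2 F) n t) t := by
  obtain ⟨a, hca, hat⟩ := exists_between ht
  have hK : IsCompact ((Set.Icc 0 (P.period 0) ×ˢ Set.Icc 0 (P.period 1)) ×ˢ Set.Icc a (t + 1)) :=
    isCompact_closedBox.prod isCompact_Icc
  have hcont : ContinuousOn (fun z : (ℝ × ℝ) × ℝ => pd 2 F (point z.1 z.2))
      ((Set.Icc 0 (P.period 0) ×ˢ Set.Icc 0 (P.period 1)) ×ˢ Set.Icc a (t + 1)) :=
    (continuousOn_pd_above hF 2).comp continuous_point.continuousOn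
      fun z hz => hca.trans_le hz.2.1
  obtain ⟨C, hC⟩ := hK.exists_bound_of_continuousOn hcont
  refine (hasDerivAt_integral_of_dominated_loc_of_deriv_le (μ := volume.restrict P.box)
    (F := fun τ p => F (point p τ) * star (P.wave n p))
    (F' := fun τ p => pd 2 F (point p τ) * star (P.wave n p)) (bound := fun _ => C)
    (s := Set.Ioo a (t + 1)) (Ioo_mem_nhds hat (by linarith)) ?_
    (integrableOn_coef hF.continuousOn ht n)
    (integrableOn_coef (continuousOn_pd_above hF 2) ht n).aestronglyMeasurable ?_
    (integrableOn_const volume_box_lt_top.ne) ?_).2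
  · filter_upwards [lt_mem_nhds ht] with τ hτ
    exact (integrableOn_coef hF.continuousOn hτ n).aestronglyMeasurable
  · filter_upwards [ae_restrict_mem measurableSet_box] with p hp τ hτ
    rw [norm_mul, norm_star, norm_wave, mul_one]
    exact hC (p, τ) ⟨box_subset hp, hτ.1.le, hτ.2.le⟩
  · refine ae_of_all _ fun p τ hτ => ?_
    exact (hasDerivAt_line 2 (hasDerivAt_vec_two p.1 p.2 τ)
      (differentiableAt_above hF (x := point p τ) (hca.trans hτ.1))).mul_const _

end Derivatives

/-! ### Orthogonality and superpositions of plane waves -/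

theorem integral_exp_period {Λ : ℝ} (hΛ : 0 < Λ) (k : ℤ) :
    ∫ x in Set.Ioc 0 Λ, Complex.exp (Complex.I * (2 * Real.pi * k / Λ) * x)
      = if k = 0 then (Λ : ℂ) else 0 := by
  rw [← intervalIntegral.integral_of_le hΛ.le]
  split_ifs with hk
  · simp [hk]
  · have hΛ' : (Λ : ℂ) ≠ 0 := by exact_mod_cast hΛ.ne'
    have hc : Complex.I * (2 * Real.pi * k / Λ) ≠ 0 := by
      simp [Complex.I_ne_zero, Real.pi_ne_zero, hk, hΛ.ne']
    rw [integral_exp_mul_complex hc]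
    have : Complex.I * (2 * Real.pi * k / Λ) * Λ = k * (2 * Real.pi * Complex.I) := by
      field_simp
    rw [this, Complex.exp_int_mul_two_pi_mul_I]
    simp

theorem integral_wave_mul_star_wave (m n : Fin 2 → ℤ) :
    ∫ p in P.box, P.wave m p * star (P.wave n p)
      = if m = n then ((P.period 0 * P.period 1 : ℝ) : ℂ) else 0 := by
  have h : ∀ p : ℝ × ℝ, P.wave m p * star (P.wave n p)
      = Complex.exp (Complex.I * (2 * Real.pi * (m 0 - n 0 : ℤ) / P.period 0) * p.1)
        * Complex.exp (Complex.I * (2 * Real.pi * (m 1 - n 1 : ℤ) / P.period 1) * p.2) := by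
    intro p
    rw [star_wave, wave, ← Complex.exp_add, ← Complex.exp_add]
    congr 1
    simp [alphaDot, alphaN]
    ring
  simp only [h]
  rw [box, Measure.volume_eq_prod, setIntegral_prod_mul
    (fun x : ℝ => Complex.exp (Complex.I * (2 * Real.pi * (m 0 - n 0 : ℤ) / P.period 0) * x))
    (fun x : ℝ => Complex.exp (Complex.I * (2 * Real.pi * (m 1 - n 1 : ℤ) / P.period 1) * x)),
    integral_exp_period (P.period_pos 0), integral_exp_period (P.period_pos 1)]
  simp only [sub_eq_zero, funext_iff, Fin.forall_fin_two]
  split_ifs <;> simp_all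

/-- A pointwise convergent superposition of plane waves may be integrated term by term over the
period, since its coefficients are absolutely summable. -/
theorem hasSum_integral_box {a : (Fin 2 → ℤ) → ℂ} {v g : ℝ × ℝ → ℂ} (hg : Continuous g)
    (hv : ∀ p, HasSum (fun m => a m * P.wave m p) (v p)) :
    HasSum (fun m => a m * ∫ p in P.box, P.wave m p * g p) (∫ p in P.box, v p * g p) := by
  have hsum : Summable fun m => ‖a m‖ := by
    have := (hv (0, 0)).summable.norm
    simpa [norm_mul, norm_wave] using this
  have h := hasSum_integral_of_summable_integral_norm (μ := volume.restrict P.box)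
    (F := fun m p => a m * P.wave m p * g p)
    (fun m => integrableOn_box ((continuous_const.mul (continuous_wave m)).mul hg))
    (by
      simp only [norm_mul, norm_wave, mul_one, integral_const_mul]
      exact hsum.mul_right _)
  have e : ∫ p in P.box, v p * g p = ∫ p in P.box, ∑' m, a m * P.wave m p * g p :=
    integral_congr_ae (ae_of_all _ fun p => by
      beta_reduce
      rw [tsum_mul_right, (hv p).tsum_eq])
  rw [e]
  simpa only [mul_assoc, integral_const_mul] using h

/-- The Fourier coefficients of a superposition of plane waves are its amplitudes. -/
theorem integral_mul_star_wave {a : (Fin 2 → ℤ) → ℂ} {v : ℝ × ℝ → ℂ}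
    (hv : ∀ p, HasSum (fun m => a m * P.wave m p) (v p)) (n : Fin 2 → ℤ) :
    ∫ p in P.box, v p * star (P.wave n p) = (P.period 0 * P.period 1 : ℝ) * a n := by
  have h := hasSum_integral_box (continuous_star_wave (P := P) n) hv
  have h' := hasSum_single (f := fun m => a m * ∫ p in P.box, P.wave m p * star (P.wave n p)) n
    fun m hm => by rw [integral_wave_mul_star_wave, if_neg hm, mul_zero]
  rw [h.unique h', integral_wave_mul_star_wave, if_pos rfl, mul_comm]

/-- Parseval's relation between a continuous function and a superposition of plane waves. -/
theorem hasSum_integral_mul_star {a : (Fin 2 → ℤ) → ℂ} {v g : ℝ × ℝ → ℂ} (hg : Continuous g)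
    (hv : ∀ p, HasSum (fun m => a m * P.wave m p) (v p)) :
    HasSum (fun m => (∫ p in P.box, g p * star (P.wave m p)) * star (a m))
      (∫ p in P.box, g p * star (v p)) := by
  have h := (hasSum_integral_box hg.star hv).star
  have hs : ∀ f : ℝ × ℝ → ℂ, star (∫ p in P.box, f p) = ∫ p in P.box, star (f p) :=
    fun f => integral_conj.symm
  simp only [star_mul', hs, star_star] at h
  convert h using 1
  · simp only [mul_comm]
  · simp only [mul_comm]

end Config

/-! ### Wave numbers and finiteness of the set of propagating modes -/

namespace Config

variable {P : Config}

theorem lam_add_two_mu_pos : 0 < P.lam + 2 * P.mu := by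
  linarith [P.mu_pos, P.lam_add_mu_pos]

theorem kappa1_pos : 0 < P.kappa1 := div_pos P.omega_pos (Real.sqrt_pos.2 lam_add_two_mu_pos)

theorem kappa2_pos : 0 < P.kappa2 := div_pos P.omega_pos (Real.sqrt_pos.2 P.mu_pos)

theorem kappa1_sq : P.kappa1 ^ 2 * (P.lam + 2 * P.mu) = P.omega ^ 2 := by
  have := lam_add_two_mu_pos (P := P)
  rw [kappa1, div_pow, Real.sq_sqrt this.le]
  field_simp

theorem kappa2_sq : P.kappa2 ^ 2 * P.mu = P.omega ^ 2 := by
  have := P.mu_pos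
  rw [kappa2, div_pow, Real.sq_sqrt this.le]
  field_simp

theorem kappa1_sq_lt : P.kappa1 ^ 2 < P.kappa2 ^ 2 := by
  have h1 := kappa1_sq (P := P)
  have h2 := kappa2_sq (P := P)
  have h3 : 0 < P.kappa1 ^ 2 := pow_pos kappa1_pos 2
  nlinarith [P.mu_pos, P.lam_add_mu_pos, mul_pos h3 P.lam_add_mu_pos]

theorem beta_pos : 0 < P.beta :=
  mul_pos kappa1_pos (Real.cos_pos_of_mem_Ioo
    ⟨by linarith [P.theta1_mem.1, Real.pi_pos], P.theta1_mem.2⟩)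

theorem alphaAbs_sq (n : Fin 2 → ℤ) :
    P.alphaAbs n ^ 2 = P.alphaN n 0 ^ 2 + P.alphaN n 1 ^ 2 :=
  Real.sq_sqrt (by positivity)

theorem alphaAbs_nonneg (n : Fin 2 → ℤ) : 0 ≤ P.alphaAbs n := Real.sqrt_nonneg _

theorem betaN_sq {κ : ℝ} (hκ : 0 < κ) (n : Fin 2 → ℤ) :
    P.betaN κ n ^ 2 = (κ : ℂ) ^ 2 - ((P.alphaN n 0 : ℂ) ^ 2 + (P.alphaN n 1 : ℂ) ^ 2) := by
  have h0 := alphaAbs_nonneg (P := P) n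
  have h : (P.alphaN n 0 : ℂ) ^ 2 + (P.alphaN n 1 : ℂ) ^ 2 = ((P.alphaAbs n ^ 2 : ℝ) : ℂ) := by
    rw [alphaAbs_sq]; push_cast; ring
  rw [h, betaN]
  split_ifs with hn
  · rw [← Complex.ofReal_pow, Real.sq_sqrt (sub_nonneg.2 (pow_le_pow_left₀ h0 hn 2))]
    push_cast; ring
  · rw [mul_pow, ← Complex.ofReal_pow,
      Real.sq_sqrt (sub_nonneg.2 (pow_le_pow_left₀ hκ.le (not_le.1 hn).le 2)), Complex.I_sq]
    push_cast; ring

theorem star_betaN_of_mem {κ : ℝ} {n : Fin 2 → ℤ} (hn : n ∈ P.propagating κ) :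
    star (P.betaN κ n) = P.betaN κ n := by
  rw [betaN, if_pos (show P.alphaAbs n ≤ κ from hn)]
  exact Complex.conj_ofReal _

theorem star_betaN_of_notMem {κ : ℝ} {n : Fin 2 → ℤ} (hn : n ∉ P.propagating κ) :
    star (P.betaN κ n) = -P.betaN κ n := by
  rw [betaN, if_neg (show ¬ P.alphaAbs n ≤ κ from hn)]
  simp

theorem re_betaN_of_notMem {κ : ℝ} {n : Fin 2 → ℤ} (hn : n ∉ P.propagating κ) :
    (P.betaN κ n).re = 0 := by
  rw [betaN, if_neg (show ¬ P.alphaAbs n ≤ κ from hn)]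
  simp

theorem ofReal_re_betaN {κ : ℝ} {n : Fin 2 → ℤ} (hn : n ∈ P.propagating κ) :
    ((P.betaN κ n).re : ℂ) = P.betaN κ n := by
  rw [betaN, if_pos (show P.alphaAbs n ≤ κ from hn), Complex.ofReal_re]

theorem alphaAbs_zero : P.alphaAbs 0 = P.kappa1 * Real.sin P.theta1 := by
  have hs : 0 ≤ Real.sin P.theta1 := Real.sin_nonneg_of_nonneg_of_le_pi P.theta1_mem.1
    (by linarith [P.theta1_mem.2, Real.pi_pos])
  have h : P.alphaN 0 0 ^ 2 + P.alphaN 0 1 ^ 2 = (P.kappa1 * Real.sin P.theta1) ^ 2 := by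
    simp only [alphaN, alpha, Pi.zero_apply, Int.cast_zero, mul_zero, zero_div, add_zero,
      Matrix.cons_val]
    linear_combination
      (P.kappa1 * Real.sin P.theta1) ^ 2 * Real.sin_sq_add_cos_sq P.theta2
  rw [alphaAbs, h, Real.sqrt_sq (mul_nonneg kappa1_pos.le hs)]

theorem zero_mem_propagating : (0 : Fin 2 → ℤ) ∈ P.propagating P.kappa1 := by
  change P.alphaAbs 0 ≤ P.kappa1
  rw [alphaAbs_zero]
  exact mul_le_of_le_one_right kappa1_pos.le (Real.sin_le_one _)

theorem betaN_zero : P.betaN P.kappa1 0 = P.beta := by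
  have h : P.kappa1 ^ 2 - P.alphaAbs 0 ^ 2 = P.beta ^ 2 := by
    rw [alphaAbs_zero, beta]
    linear_combination (-P.kappa1 ^ 2) * Real.sin_sq_add_cos_sq P.theta1
  rw [betaN, if_pos (show P.alphaAbs 0 ≤ P.kappa1 from zero_mem_propagating), h,
    Real.sqrt_sq beta_pos.le]

/-- The set is finite because each component of `α^{(n)}` runs through an arithmetic progression. -/
theorem finite_propagating (P : Config) (κ : ℝ) : (P.propagating κ).Finite := by
  have hk : ∀ k : Fin 2, {m : ℤ | |P.alpha k + 2 * Real.pi * m / P.period k| ≤ κ}.Finite := by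
    intro k
    have hp := P.period_pos k
    set c := 2 * Real.pi / P.period k with hc
    have hc0 : 0 < c := by positivity
    refine (Set.finite_Icc ⌈(-κ - P.alpha k) / c⌉ ⌊(κ - P.alpha k) / c⌋).subset fun m hm => ?_
    have hm' : |P.alpha k + c * m| ≤ κ := by
      have : P.alpha k + c * m = P.alpha k + 2 * Real.pi * m / P.period k := by rw [hc]; ring
      rw [this]; exact hm
    obtain ⟨h1, h2⟩ := abs_le.1 hm'
    refine ⟨Int.ceil_le.2 ?_, Int.le_floor.2 ?_⟩
    · rw [div_le_iff₀ hc0]; linarith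
    · rw [le_div_iff₀ hc0]; linarith
  refine (Set.Finite.pi' hk).subset fun n hn k => ?_
  have hn' : P.alphaAbs n ≤ κ := hn
  refine le_trans ?_ hn'
  refine Real.abs_le_sqrt ?_
  fin_cases k
  · exact le_add_of_nonneg_right (sq_nonneg (P.alphaN n 1))
  · exact le_add_of_nonneg_left (sq_nonneg (P.alphaN n 0))

end Config

/-! ### Superpositions of vertical exponentials -/

/-- The function `t ↦ ∑ₗ cₗ exp(i bₗ t)`. -/
def modeSum (b c : Fin 3 → ℂ) (t : ℝ) : ℂ := ∑ l, c l * Complex.exp (Complex.I * b l * t)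

theorem hasDerivAt_modeSum (b c : Fin 3 → ℂ) (t : ℝ) :
    HasDerivAt (modeSum b c) (modeSum b (fun l => Complex.I * b l * c l) t) t := by
  refine HasDerivAt.fun_sum fun l _ => ?_
  have h : HasDerivAt (fun s : ℝ => Complex.I * b l * (s : ℂ)) (Complex.I * b l * 1) t :=
    (hasDerivAt_id' t).ofReal_comp.const_mul _
  refine (h.cexp.const_mul (c l)).congr_deriv ?_
  ring

theorem modeSum_add (b c d : Fin 3 → ℂ) (t : ℝ) :
    modeSum b (fun l => c l + d l) t = modeSum b c t + modeSum b d t := by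
  simp only [modeSum, add_mul, Finset.sum_add_distrib]

theorem modeSum_sub (b c d : Fin 3 → ℂ) (t : ℝ) :
    modeSum b (fun l => c l - d l) t = modeSum b c t - modeSum b d t := by
  simp only [modeSum, sub_mul, Finset.sum_sub_distrib]

theorem modeSum_const_mul (b c : Fin 3 → ℂ) (a : ℂ) (t : ℝ) :
    modeSum b (fun l => a * c l) t = a * modeSum b c t := by
  simp only [modeSum, mul_assoc, Finset.mul_sum]

/-- Two exponentials with different exponents are linearly independent on a half-line. -/
theorem eq_zero_of_modeSum_eq_zero {b c : Fin 3 → ℂ} {h : ℝ} (hb : b 1 ≠ b 2) (h0 : c 0 = 0)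
    (hc : ∀ t, h < t → modeSum b c t = 0) : c 1 = 0 ∧ c 2 = 0 := by
  have h1 : h < h + 1 := by linarith
  have hd : modeSum b (fun l => Complex.I * b l * c l) (h + 1) = 0 := by
    refine (hasDerivAt_modeSum b c (h + 1)).unique ?_
    refine (hasDerivAt_const (h + 1) (0 : ℂ)).congr_of_eventuallyEq ?_
    filter_upwards [lt_mem_nhds h1] with t ht using hc t ht
  have he := hc _ h1
  simp only [modeSum, Fin.sum_univ_three, h0] at hd he
  have hsub : b 1 - b 2 ≠ 0 := sub_ne_zero.2 hb
  constructor
  · have : Complex.I * (b 1 - b 2) * c 1 * Complex.exp (Complex.I * b 1 * (h + 1 : ℝ)) = 0 := by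
      linear_combination hd - Complex.I * b 2 * he
    simpa [Complex.exp_ne_zero, hsub, Complex.I_ne_zero] using this
  · have : Complex.I * (b 1 - b 2) * c 2 * Complex.exp (Complex.I * b 2 * (h + 1 : ℝ)) = 0 := by
      linear_combination - hd + Complex.I * b 1 * he
    simpa [Complex.exp_ne_zero, hsub, Complex.I_ne_zero] using this

namespace Config

variable {P : Config}

/-- The `n`-th Fourier coefficient of `F` above height `h` is `∑ₗ cₗ exp(i bₗ x₃)`. -/
def HasModes (P : Config) (n : Fin 2 → ℤ) (b : Fin 3 → ℂ) (F : Pt → ℂ) (c : Fin 3 → ℂ) : Prop :=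
  ∀ t, P.h < t → P.coef F n t = (P.period 0 * P.period 1 : ℝ) * modeSum b c t

/-- The wave vector `(α₁^{(n)}, α₂^{(n)}, b)`. -/
def waveVec (P : Config) (n : Fin 2 → ℤ) (b : ℂ) : Fin 3 → ℂ := ![P.alphaN n 0, P.alphaN n 1, b]

namespace HasModes

variable {n : Fin 2 → ℤ} {b c d : Fin 3 → ℂ} {F G : Pt → ℂ} {c₀ : ℝ}

theorem congr (hF : P.HasModes n b F c) (h : ∀ x ∈ above P.h, G x = F x) :
    P.HasModes n b G c := fun t ht => by
  rw [coef_congr ht h, hF t ht]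

theorem congr_amp (hF : P.HasModes n b F c) (h : ∀ l, d l = c l) : P.HasModes n b F d := by
  rw [funext h]; exact hF

theorem const_mul (hF : P.HasModes n b F c) (a : ℂ) :
    P.HasModes n b (fun x => a * F x) (fun l => a * c l) := fun t ht => by
  rw [coef_const_mul, hF t ht, modeSum_const_mul]; ring

theorem add (hF : P.HasModes n b F c) (hG : P.HasModes n b G d)
    (hF' : ContinuousOn F (above P.h)) (hG' : ContinuousOn G (above P.h)) :
    P.HasModes n b (fun x => F x + G x) (fun l => c l + d l) := fun t ht => by
  rw [coef_add hF' hG' ht, hF t ht, hG t ht, modeSum_add]; ring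

theorem sub (hF : P.HasModes n b F c) (hG : P.HasModes n b G d)
    (hF' : ContinuousOn F (above P.h)) (hG' : ContinuousOn G (above P.h)) :
    P.HasModes n b (fun x => F x - G x) (fun l => c l - d l) := fun t ht => by
  rw [coef_sub hF' hG' ht, hF t ht, hG t ht, modeSum_sub]; ring

/-- Differentiation multiplies the amplitudes by `i` times a component of the wave vector. -/
theorem pd (hF : P.HasModes n b F c) (hF' : ContDiffOn ℝ 1 F (above P.h)) (hq : P.QPOn P.h F)
    (j : Fin 3) :
    P.HasModes n b (pd j F) (fun l => Complex.I * P.waveVec n (b l) j * c l) := fun t ht => by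
  fin_cases j
  · simp only [Fin.zero_eta, coef_pd_zero hF' hq ht, hF t ht, waveVec, Matrix.cons_val,
      modeSum_const_mul]
    ring
  · simp only [Fin.mk_one, coef_pd_one hF' hq ht, hF t ht, waveVec, Matrix.cons_val,
      modeSum_const_mul]
    ring
  · refine (hasDerivAt_coef hF' ht n).unique ?_
    refine ((hasDerivAt_modeSum b c t).const_mul _).congr_of_eventuallyEq ?_
    filter_upwards [lt_mem_nhds ht] with s hs using hF s hs

end HasModes

end Config

/-! ### Energy flux of the modes -/

/-- The bilinear (not sesquilinear) dot product on `ℂ³`. -/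
def dot (k v : Fin 3 → ℂ) : ℂ := k 0 * v 0 + k 1 * v 1 + k 2 * v 2

/-- The cross product on `ℂ³`. -/
def cross (k v : Fin 3 → ℂ) : Fin 3 → ℂ :=
  ![k 1 * v 2 - k 2 * v 1, k 2 * v 0 - k 0 * v 2, k 0 * v 1 - k 1 * v 0]

/-- The equation `v = -κ₁⁻² D(D·v) + κ₂⁻² D×(D×v)`, with `D = ik` and `k·k = κ₁²`, forces the
amplitude `v` to be longitudinal. -/
theorem longitudinal_of_eq {k v : Fin 3 → ℂ} {x y : ℂ} (hx : x ≠ 0) (hy : y ≠ 0) (hxy : x ≠ y)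
    (hk : dot k k = x)
    (hv : ∀ i, v i = x⁻¹ * (k i * dot k v)
      - y⁻¹ * (k i * dot k v - dot k k * v i)) (i : Fin 3) :
    v i = x⁻¹ * dot k v * k i := by
  have h := hv i
  rw [hk] at h
  have hd : y - x ≠ 0 := sub_ne_zero.2 hxy.symm
  field_simp at h ⊢
  refine mul_left_cancel₀ hd ?_
  linear_combination h

/-- The same equation with `k·k = κ₂²` forces the amplitude `v` to be transversal. -/
theorem transversal_of_eq {k v : Fin 3 → ℂ} {x y : ℂ} (hx : x ≠ 0) (hy : y ≠ 0) (hxy : x ≠ y)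
    (hk : dot k k = y)
    (hv : ∀ i, v i = x⁻¹ * (k i * dot k v)
      - y⁻¹ * (k i * dot k v - dot k k * v i)) :
    dot k v = 0 := by
  have hd : y - x ≠ 0 := sub_ne_zero.2 hxy.symm
  have h : ∀ i, (y - x) * (k i * dot k v) = 0 := by
    intro i
    have h := hv i
    rw [hk] at h
    field_simp at h
    linear_combination -h
  have h2 : (y - x) * y * dot k v = 0 := by
    have hk' := hk
    simp only [dot] at h hk' ⊢
    linear_combination k 0 * h 0 + k 1 * h 1 + k 2 * h 2
      - (y - x) * (k 0 * v 0 + k 1 * v 1 + k 2 * v 2) * hk'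
  simpa [hd, hy] using h2

/-- The vertical energy flux of a field that is the sum of a downward compressional wave of
amplitude `p`, an upward compressional wave of amplitude `r` and an upward shear wave with
amplitude vector `w`. All interactions between different waves cancel. The letters with a
dash stand for the complex conjugates. -/
theorem flux_identity {a₀ a₁ b₁ b₁' b₂ b₂' p p' r r' m l x y o : ℂ} {w w' : Fin 3 → ℂ}
    (hb₁ : b₁ ^ 2 = x - (a₀ ^ 2 + a₁ ^ 2)) (hb₂ : b₂ ^ 2 = y - (a₀ ^ 2 + a₁ ^ 2))
    (hb₂' : b₂' ^ 2 = y - (a₀ ^ 2 + a₁ ^ 2))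
    (hcase : b₁' = b₁ ∨ (b₁' = -b₁ ∧ p = 0 ∧ p' = 0))
    (hw : a₀ * w 0 + a₁ * w 1 + b₂ * w 2 = 0) (hw' : a₀ * w' 0 + a₁ * w' 1 + b₂' * w' 2 = 0)
    (hx : x * (l + 2 * m) = o) (hy : y * m = o) :
    (m * ((-b₁ * (p * a₀) + b₁ * (r * a₀) + b₂ * w 0) * (p' * a₀ + r' * a₀ + w' 0)
        + (-b₁ * (p * a₁) + b₁ * (r * a₁) + b₂ * w 1) * (p' * a₁ + r' * a₁ + w' 1)
        + (b₁ * (p * b₁) + b₁ * (r * b₁) + b₂ * w 2) * (-(p' * b₁') + r' * b₁' + w' 2))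
      + (l + m) * (x * (p + r)) * (-(p' * b₁') + r' * b₁' + w' 2))
    + (m * ((-b₁' * (p' * a₀) + b₁' * (r' * a₀) + b₂' * w' 0) * (p * a₀ + r * a₀ + w 0)
        + (-b₁' * (p' * a₁) + b₁' * (r' * a₁) + b₂' * w' 1) * (p * a₁ + r * a₁ + w 1)
        + (b₁' * (p' * b₁') + b₁' * (r' * b₁') + b₂' * w' 2) * (-(p * b₁) + r * b₁ + w 2))
      + (l + m) * (x * (p' + r')) * (-(p * b₁) + r * b₁ + w 2))
    = (b₁ + b₁') * o * (r * r' - p * p')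
      + m * (b₂ + b₂') * (w 0 * w' 0 + w 1 * w' 1 + w 2 * w' 2) := by
  rcases hcase with rfl | ⟨rfl, rfl, rfl⟩
  · linear_combination (r * m * (b₁' + b₂') + p * m * (-b₁' + b₂')) * hw'
      + (r' * m * (b₁' + b₂) + p' * m * (-b₁' + b₂)) * hw
      + (r + p) * w' 2 * (m * (hb₁ - hb₂') + (hx - hy))
      + (r' + p') * w 2 * (m * (hb₁ - hb₂) + (hx - hy))
      + 2 * b₁' * (r * r' - p * p') * (m * hb₁ + hx)
  · linear_combination (r * m * (b₁ + b₂')) * hw'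
      + (r' * m * (-b₁ + b₂)) * hw
      + r * w' 2 * (m * (hb₁ - hb₂') + (hx - hy))
      + r' * w 2 * (m * (hb₁ - hb₂) + (hx - hy))

/-- If `k` is orthogonal to `v`, then `(k × v)·(k × v') = (k·k) (v·v')`. -/
theorem dot_cross_cross {k v v' : Fin 3 → ℂ} (hv : dot k v = 0) :
    dot (cross k v) (cross k v') = dot k k * dot v v' := by
  simp only [dot, cross, Matrix.cons_val] at hv ⊢
  linear_combination - (k 0 * v' 0 + k 1 * v' 1 + k 2 * v' 2) * hv

/-! ### Weak derivatives -/

theorem IsLocL2.locallyIntegrable {F : Pt → ℂ} (hF : IsLocL2 F) : LocallyIntegrable F :=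
  locallyIntegrable_iff.2 fun K hK => by
    have : IsFiniteMeasure (volume.restrict K) := ⟨by simpa using hK.measure_lt_top⟩
    exact (hF K hK).integrable (by norm_num)

theorem IsLocL2.continuous_mul {F g : Pt → ℂ} (hF : IsLocL2 F) (hg : Continuous g) :
    IsLocL2 (fun x => g x * F x) := fun K hK => by
  obtain ⟨C, hC⟩ := hK.exists_bound_of_continuousOn hg.continuousOn
  refine (hF K hK).of_le_mul (c := C) (hg.aestronglyMeasurable.mul (hF K hK).1) ?_
  filter_upwards [ae_restrict_mem hK.measurableSet] with x hx
  rw [norm_mul]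
  exact mul_le_mul_of_nonneg_right (hC x hx) (norm_nonneg _)

theorem IsLocL2.add {F G : Pt → ℂ} (hF : IsLocL2 F) (hG : IsLocL2 G) :
    IsLocL2 (fun x => F x + G x) := fun K hK => (hF K hK).add (hG K hK)

theorem contDiff_pd {g : Pt → ℂ} (hg : ContDiff ℝ ∞ g) (j : Fin 3) : ContDiff ℝ ∞ (pd j g) :=
  (hg.fderiv_right (m := ∞) (by simp)).clm_apply contDiff_const

theorem hasCompactSupport_pd {g : Pt → ℂ} (hg : HasCompactSupport g) (j : Fin 3) :
    HasCompactSupport (pd j g) := hg.fderiv_apply ℝ _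

theorem LocallyIntegrable.integrable_mul_test {F η : Pt → ℂ} (hF : LocallyIntegrable F)
    (hη : Continuous η) (hs : HasCompactSupport η) : Integrable (fun x => F x * η x) := by
  simpa only [smul_eq_mul, mul_comm] using hF.integrable_smul_left_of_hasCompactSupport hη hs

/-- Product rule for a weak derivative and a smooth factor. -/
theorem IsWeakPartial.mul_smooth {j : Fin 3} {F G g : Pt → ℂ} (hw : IsWeakPartial j F G)
    (hF : IsLocL2 F) (hG : IsLocL2 G) (hg : ContDiff ℝ ∞ g) :
    IsWeakPartial j (fun x => g x * F x) (fun x => g x * G x + pd j g x * F x) := by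
  intro η hη hs
  have hgd : ∀ x, DifferentiableAt ℝ g x := fun x =>
    (hg.differentiable (by simp)).differentiableAt
  have hηd : ∀ x, DifferentiableAt ℝ η x := fun x =>
    (hη.differentiable (by simp)).differentiableAt
  have hmul := hw (fun x => g x * η x) (hg.mul hη) (hs.mul_left)
  have hpg : Continuous (pd j g) := (contDiff_pd hg j).continuous
  have hpη : Continuous (pd j η) := (contDiff_pd hη j).continuous
  have i1 : Integrable fun x => F x * (g x * pd j η x) :=
    LocallyIntegrable.integrable_mul_test hF.locallyIntegrable (hg.continuous.mul hpη)
      (hasCompactSupport_pd hs j).mul_left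
  have i2 : Integrable fun x => F x * (pd j g x * η x) :=
    LocallyIntegrable.integrable_mul_test hF.locallyIntegrable (hpg.mul hη.continuous)
      hs.mul_left
  have i3 : Integrable fun x => G x * (g x * η x) :=
    LocallyIntegrable.integrable_mul_test hG.locallyIntegrable (hg.continuous.mul hη.continuous)
      hs.mul_left
  have e1 : ∀ x, F x * pd j (fun y => g y * η y) x
      = F x * (g x * pd j η x) + F x * (pd j g x * η x) := fun x => by
    rw [pd_mul j (hgd x) (hηd x)]; ring
  have e2 : ∀ x, (g x * G x + pd j g x * F x) * η x
      = G x * (g x * η x) + F x * (pd j g x * η x) := fun x => by ring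
  have e3 : ∀ x, g x * F x * pd j η x = F x * (g x * pd j η x) := fun x => by ring
  simp only [e1] at hmul
  simp only [e2, e3]
  rw [integral_add i1 i2] at hmul
  rw [integral_add i3 i2]
  linear_combination hmul

/-- Integration by parts against a smooth function supported in the open set where `F` is
continuously differentiable. -/
theorem integral_mul_pd {j : Fin 3} {F ζ : Pt → ℂ} {U : Set Pt} (hU : IsOpen U)
    (hF : ContDiffOn ℝ 1 F U) (hζ : ContDiff ℝ ∞ ζ) (hs : HasCompactSupport ζ)
    (hsub : tsupport ζ ⊆ U) :
    Integrable (fun x => ζ x * pd j F x) ∧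
      ∫ x, F x * pd j ζ x = -∫ x, ζ x * pd j F x := by
  have hc : ContinuousOn (pd j F) U :=
    (contDiffOn_pd (m := 0) j hU (by norm_num) hF).continuousOn
  have hint : ∀ f g : Pt → ℂ, ContinuousOn f U → Continuous g → tsupport g ⊆ tsupport ζ →
      Integrable fun x => g x * f x := by
    intro f g hf hg hgs
    have hcomp : IsCompact (tsupport ζ) := hs
    have : IntegrableOn (fun x => g x * f x) (tsupport ζ) :=
      (hg.continuousOn.mul (hf.mono hsub)).integrableOn_compact hcomp
    refine this.integrable_of_forall_notMem_eq_zero fun x hx => ?_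
    rw [image_eq_zero_of_notMem_tsupport fun h => hx (hgs h), zero_mul]
  have hpsub : tsupport (pd j ζ) ⊆ tsupport ζ :=
    closure_minimal (fun x hx => by
      by_contra h
      exact hx (by rw [pd, fderiv_of_notMem_tsupport ℝ h]; rfl)) (isClosed_tsupport ζ)
  have i0 := hint _ _ hc hζ.continuous subset_rfl
  refine ⟨i0, ?_⟩
  have i1 := hint F _ hF.continuousOn (contDiff_pd hζ j).continuous hpsub
  have i2 := hint F _ hF.continuousOn hζ.continuous subset_rfl
  have d1 : ∀ x ∈ tsupport F, HasLineDerivAt ℝ ζ (pd j ζ x) x (Pi.single j 1) := fun x _ =>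
    (hζ.differentiable (by simp)).differentiableAt.hasFDerivAt.hasLineDerivAt _
  have d2 : ∀ x ∈ tsupport ζ, HasLineDerivAt ℝ F (pd j F x) x (Pi.single j 1) := fun x hx =>
    ((hF.contDiffAt (hU.mem_nhds (hsub hx))).differentiableAt
      (by norm_num)).hasFDerivAt.hasLineDerivAt _
  have ibp := integral_bilinear_hasLineDerivAt_right_eq_neg_left_of_integrable (μ := volume)
    (B := ContinuousLinearMap.mul ℝ ℂ) (f := ζ) (f' := pd j ζ) (g := F) (g' := pd j F)
    (v := Pi.single j 1) i1 i0 i2 d1 d2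
  simp only [ContinuousLinearMap.mul_apply'] at ibp
  simp only [mul_comm (F _)]
  rw [ibp, neg_neg]

/-- On an open set where the function is continuously differentiable, the weak derivative is the
classical one. -/
theorem IsWeakPartial.ae_eq_pd {j : Fin 3} {F G : Pt → ℂ} {U : Set Pt} (hU : IsOpen U)
    (hw : IsWeakPartial j F G) (hG : IsLocL2 G) (hF : ContDiffOn ℝ 1 F U) :
    ∀ᵐ x, x ∈ U → G x = pd j F x := by
  have hc : ContinuousOn (pd j F) U :=
    (contDiffOn_pd (m := 0) j hU (by norm_num) hF).continuousOn
  have hGl := hG.locallyIntegrable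
  have hzero : ∀ η : Pt → ℝ, ContDiff ℝ ∞ η → HasCompactSupport η → tsupport η ⊆ U →
      ∫ x, η x • (G x - pd j F x) = 0 := by
    intro η hη hs hsub
    have hζ : ContDiff ℝ ∞ fun x => (η x : ℂ) := Complex.ofRealCLM.contDiff.comp hη
    have hζs : HasCompactSupport fun x => (η x : ℂ) :=
      hs.comp_left (g := fun r : ℝ => (r : ℂ)) Complex.ofReal_zero
    have hζsub : tsupport (fun x => (η x : ℂ)) ⊆ tsupport η :=
      closure_mono (Function.support_comp_subset (g := fun r : ℝ => (r : ℂ)) Complex.ofReal_zero η)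
    obtain ⟨hi, ibp⟩ := integral_mul_pd (j := j) hU hF hζ hζs (hζsub.trans hsub)
    have hwk := hw _ hζ hζs
    have e : ∀ x, η x • (G x - pd j F x) = G x * (η x : ℂ) - (η x : ℂ) * pd j F x := fun x => by
      rw [Complex.real_smul]; ring
    simp only [e]
    rw [integral_sub (LocallyIntegrable.integrable_mul_test hGl hζ.continuous hζs) hi]
    linear_combination hwk - ibp
  have key := hU.ae_eq_zero_of_integral_contDiff_smul_eq_zero (μ := volume)
    (f := fun x => G x - pd j F x)
    ((hGl.locallyIntegrableOn U).sub (hc.locallyIntegrableOn hU.measurableSet)) hzero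
  filter_upwards [key] with x hx hxU using sub_eq_zero.1 (hx hxU)

/-! ### The energy identity from the weak formulation -/

/-- A smooth function of the height, as a function of the point. -/
def vert (χ : ℝ → ℝ) (x : Pt) : ℂ := (χ (x 2) : ℂ)

theorem contDiff_vert {χ : ℝ → ℝ} (hχ : ContDiff ℝ ∞ χ) : ContDiff ℝ ∞ (vert χ) :=
  Complex.ofRealCLM.contDiff.comp (hχ.comp (contDiff_apply ℝ ℝ 2))

theorem pd_vert {χ : ℝ → ℝ} (hχ : ContDiff ℝ ∞ χ) (j : Fin 3) (x : Pt) :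
    pd j (vert χ) x = if j = 2 then ((deriv χ (x 2) : ℝ) : ℂ) else 0 := by
  have h1 : HasFDerivAt (fun y : Pt => y 2) (ContinuousLinearMap.proj (R := ℝ) 2) x :=
    hasFDerivAt_apply 2 x
  have h2 : HasDerivAt (fun t => ((χ t : ℝ) : ℂ)) ((deriv χ (x 2) : ℝ) : ℂ) (x 2) :=
    ((hχ.differentiable (by simp)).differentiableAt.hasDerivAt).ofReal_comp
  have h3 : HasFDerivAt ((fun t => ((χ t : ℝ) : ℂ)) ∘ fun y : Pt => y 2) _ x :=
    HasFDerivAt.comp x h2.hasFDerivAt h1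
  rw [pd, show vert χ = (fun t => ((χ t : ℝ) : ℂ)) ∘ fun y : Pt => y 2 from rfl, h3.fderiv]
  fin_cases j <;> simp

/-- The coordinates `(x₃, (x₁, x₂))` as a measurable equivalence. -/
def splitHeight : Pt ≃ᵐ ℝ × (ℝ × ℝ) :=
  (MeasurableEquiv.piFinSuccAbove (fun _ : Fin 3 => ℝ) 2).trans
    ((MeasurableEquiv.refl ℝ).prodCongr MeasurableEquiv.finTwoArrow)

theorem splitHeight_apply (x : Pt) : splitHeight x = (x 2, (x 0, x 1)) := rfl

theorem measurePreserving_splitHeight : MeasurePreserving splitHeight :=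
  ((MeasurePreserving.id volume).prod (volume_preserving_finTwoArrow ℝ)).comp
    (volume_preserving_piFinSuccAbove (fun _ : Fin 3 => ℝ) 2)

theorem point_eta (x : Pt) : point (x 0, x 1) (x 2) = x := by
  ext i; fin_cases i <;> rfl

namespace Config

variable {P : Config} {u : Pt → Fin 3 → ℂ} {G : Fin 3 → Fin 3 → Pt → ℂ}

/-- The vertical component of the (complex) energy flux density, in terms of the field and its
gradient. -/
def fluxDensity (P : Config) (u : Pt → Fin 3 → ℂ) (G : Fin 3 → Fin 3 → Pt → ℂ) (x : Pt) : ℂ :=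
  (P.mu : ℂ) * (∑ i, G i 2 x * star (u x i))
    + ((P.lam + P.mu : ℝ) : ℂ) * ((∑ i, G i i x) * star (u x 2))

/-- Truncating the total field at a finite height gives a test field. -/
theorem isH1Field_cutoff (hu : P.IsH1Field u G) {χ : ℝ → ℝ} (hχ : ContDiff ℝ ∞ χ) :
    P.IsH1Field (fun x i => vert χ x * u x i)
      (fun i j x => vert χ x * G i j x + pd j (vert χ) x * u x i) := by
  have hv := contDiff_vert hχ
  refine ⟨fun n x i => ?_, fun x hx => ?_, fun i => ?_, fun i j => ?_, fun i j => ?_⟩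
  · simp only [hu.quasiPeriodic n x i, vert, Matrix.cons_val]; ring
  · ext i; simp [hu.zero_below x hx]
  · exact (hu.locL2 i).continuous_mul hv.continuous
  · exact ((hu.locL2_grad i j).continuous_mul hv.continuous).add
      ((hu.locL2 i).continuous_mul (contDiff_pd hv j).continuous)
  · exact (hu.weakPartial i j).mul_smooth (hu.locL2 i) (hu.locL2_grad i j) hv

/-- The part of the period cell below a given height is bounded. -/
theorem exists_isCompact_cell (P : Config) (H : ℝ) :
    ∃ K : Set Pt, IsCompact K ∧ ∀ x ∈ P.cell, x 2 ≤ H → x ∈ K := by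
  obtain ⟨L, hL⟩ := P.f_lipschitz
  have hc : IsCompact (Set.Icc (0 : Fin 2 → ℝ) P.period) := isCompact_Icc
  obtain ⟨C, hC⟩ := hc.exists_bound_of_continuousOn hL.continuous.continuousOn
  refine ⟨Set.Icc ![0, 0, -C] ![P.period 0, P.period 1, H], isCompact_Icc, fun x hx hxH => ?_⟩
  obtain ⟨h0, h1, h2⟩ := hx
  have hf : ‖P.f (horiz x)‖ ≤ C := hC _ ⟨fun k => by
      fin_cases k
      · exact h0.1.le
      · exact h1.1.le, fun k => by
      fin_cases k
      · exact h0.2.le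
      · exact h1.2.le⟩
  rw [Real.norm_eq_abs, abs_le] at hf
  constructor <;> intro i <;> fin_cases i <;> simp <;> linarith

theorem measurableSet_cell : MeasurableSet P.cell := by
  have hd : MeasurableSet P.domain := isOpen_domain.measurableSet
  have h : ∀ k : Fin 3, Measurable fun x : Pt => x k := fun k => measurable_pi_apply k
  have : P.cell = ({x | (0 < x 0 ∧ x 0 < P.period 0)} ∩ {x | (0 < x 1 ∧ x 1 < P.period 1)})
      ∩ P.domain := by
    ext x; simp [cell, domain, and_assoc]
  rw [this]
  refine ((MeasurableSet.inter ?_ ?_).inter ?_).inter hd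
  · exact measurableSet_lt measurable_const (h 0)
  · exact measurableSet_lt (h 0) measurable_const
  · exact (measurableSet_lt measurable_const (h 1)).inter (measurableSet_lt (h 1) measurable_const)

/-- Testing the equation with a truncation of the field itself, the imaginary part of the volume
terms drops out, and only the flux through the truncation layer remains. -/
theorem integral_cell_flux_eq_zero (hu : P.IsH1Field u G)
    (hsol : ∀ w W, P.IsH1Field w W → (∃ H : ℝ, ∀ x, H ≤ x 2 → w x = 0) → P.form u G w W = 0)
    {χ : ℝ → ℝ} (hχ : ContDiff ℝ ∞ χ) {H : ℝ} (hH : ∀ t, H ≤ t → χ t = 0) :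
    ∫ x in P.cell, deriv χ (x 2) * (P.fluxDensity u G x).im = 0 := by
  have hform := hsol _ _ (isH1Field_cutoff hu hχ) ⟨H, fun x hx => by
    ext i; simp [vert, hH _ hx]⟩
  have hv := contDiff_vert hχ
  obtain ⟨K, hK, hcell⟩ := exists_isCompact_cell P (H + 1)
  have hdχ : ∀ t, H + 1 < t → deriv χ t = 0 := by
    intro t ht
    have : χ =ᶠ[𝓝 t] fun _ => 0 := by
      filter_upwards [lt_mem_nhds ht] with s hs using hH s (by linarith)
    rw [this.deriv_eq, deriv_const]
  have hw := isH1Field_cutoff hu hχ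
  unfold form at hform
  have hprod : ∀ F F' : Pt → ℂ, IsLocL2 F → IsLocL2 F' →
      IntegrableOn (fun x => F x * star (F' x)) K := fun F F' hF hF' =>
    (hF K hK).integrable_mul (hF' K hK).star
  have hint : IntegrableOn (fun x => (P.mu : ℂ) * (∑ i, ∑ j, G i j x
        * star (vert χ x * G i j x + pd j (vert χ) x * u x i))
      + ((P.lam + P.mu : ℝ) : ℂ) * ((∑ i, G i i x)
        * star (∑ i, (vert χ x * G i i x + pd i (vert χ) x * u x i)))
      - (P.omega ^ 2 : ℝ) * (∑ i, u x i * star (vert χ x * u x i))) P.cell := by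
    have hK' : IntegrableOn (fun x => (P.mu : ℂ) * (∑ i, ∑ j, G i j x
        * star (vert χ x * G i j x + pd j (vert χ) x * u x i))
      + ((P.lam + P.mu : ℝ) : ℂ) * ((∑ i, G i i x)
        * star (∑ i, (vert χ x * G i i x + pd i (vert χ) x * u x i)))
      - (P.omega ^ 2 : ℝ) * (∑ i, u x i * star (vert χ x * u x i))) K := by
      refine Integrable.sub (Integrable.add (Integrable.const_mul ?_ _)
        (Integrable.const_mul ?_ _)) (Integrable.const_mul ?_ _)
      · exact integrable_finsetSum _ fun i _ => integrable_finsetSum _ fun j _ =>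
          hprod _ _ (hu.locL2_grad i j) (hw.locL2_grad i j)
      · simp only [star_sum, Finset.sum_mul_sum]
        exact integrable_finsetSum _ fun i _ => integrable_finsetSum _ fun j _ =>
          hprod _ _ (hu.locL2_grad i i) (hw.locL2_grad j j)
      · exact integrable_finsetSum _ fun i _ => hprod _ _ (hu.locL2 i) (hw.locL2 i)
    refine (hK'.mono_set Set.inter_subset_right).of_forall_sdiff_eq_zero (s := P.cell ∩ K)
      measurableSet_cell fun x hx => ?_
    have hx2 : H + 1 < x 2 := by
      by_contra hle
      exact hx.2 ⟨hx.1, hcell x hx.1 (not_lt.1 hle)⟩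
    have hz : vert χ x = 0 := by simp [vert, hH _ (by linarith : H ≤ x 2)]
    have hz' : ∀ j, pd j (vert χ) x = 0 := fun j => by simp [pd_vert hχ, hdχ _ hx2]
    simp [hz, hz']
  have him := congrArg Complex.im hform
  rw [Complex.zero_im] at him
  rw [← him]
  refine Eq.trans ?_ (integral_im hint)
  refine integral_congr_ae (ae_of_all _ fun x => ?_)
  simp only [fluxDensity, Fin.sum_univ_three, pd_vert hχ, vert]
  simp [Complex.add_im, Complex.mul_im, Complex.mul_re, -Complex.ofReal_pow]
  ring

/-- The same identity with the classical gradient, as an iterated integral. -/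
theorem integral_flux_eq_zero (hu : P.IsH1Field u G)
    (hsol : ∀ w W, P.IsH1Field w W → (∃ H : ℝ, ∀ x, H ≤ x 2 → w x = 0) → P.form u G w W = 0)
    (hreg : ∀ i, ContDiffOn ℝ 1 (fun x => u x i) P.domain)
    {χ : ℝ → ℝ} (hχ : ContDiff ℝ ∞ χ) {a b : ℝ} (ha : P.h < a) (hχa : ∀ t, t ≤ a → χ t = 1)
    (hχb : ∀ t, b ≤ t → χ t = 0) :
    ∫ t in Set.Ioc a b, deriv χ t *
      ∫ p in P.box, (P.fluxDensity u (fun i j => pd j (fun y => u y i)) (point p t)).im = 0 := by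
  have h0 := integral_cell_flux_eq_zero hu hsol hχ hχb
  set S := P.fluxDensity u (fun i j => pd j (fun y => u y i)) with hS
  have hdom : above P.h ⊆ P.domain := fun x hx => (P.f_lt_h _).trans hx
  have hreg' : ∀ i, ContDiffOn ℝ 1 (fun x => u x i) (above P.h) := fun i => (hreg i).mono hdom
  have hScont : ContinuousOn S (above P.h) := by
    have h1 : ∀ i j, ContinuousOn (pd j (fun y => u y i)) (above P.h) := fun i j =>
      continuousOn_pd_above (hreg' i) j
    have h2 : ∀ i, ContinuousOn (fun x => star (u x i)) (above P.h) := fun i =>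
      (hreg' i).continuousOn.star
    exact (continuousOn_const.mul (continuousOn_finsetSum _ fun i _ => (h1 i 2).mul (h2 i))).add
      (continuousOn_const.mul ((continuousOn_finsetSum _ fun i _ => h1 i i).mul (h2 2)))
  have hae : ∀ᵐ x, x ∈ P.domain → ∀ i j, G i j x = pd j (fun y => u y i) x := by
    have : ∀ᵐ x, ∀ i j, x ∈ P.domain → G i j x = pd j (fun y => u y i) x :=
      ae_all_iff.2 fun i => ae_all_iff.2 fun j =>
        (hu.weakPartial i j).ae_eq_pd isOpen_domain (hu.locL2_grad i j) (hreg i)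
    filter_upwards [this] with x hx hd i j using hx i j hd
  have h1 : ∫ x in P.cell, deriv χ (x 2) * (S x).im = 0 := by
    rw [← h0]
    refine setIntegral_congr_ae measurableSet_cell ?_
    filter_upwards [hae] with x hx hxc
    have := hx hxc.2.2
    simp only [hS, fluxDensity, this]
  have hda : ∀ t, t ≤ a → deriv χ t = 0 := by
    have hlt : ∀ t ∈ Set.Iio a, deriv χ t = 0 := by
      intro t ht
      have : χ =ᶠ[𝓝 t] fun _ => 1 := by
        filter_upwards [gt_mem_nhds ht] with s hs using hχa s hs.le
      rw [this.deriv_eq, deriv_const]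
    have hcl : IsClosed {t | deriv χ t = 0} :=
      isClosed_eq (hχ.continuous_deriv (by simp)) continuous_const
    intro t ht
    have : Set.Iic a ⊆ {t | deriv χ t = 0} := by
      rw [← closure_Iio]
      exact hcl.closure_subset_iff.2 hlt
    exact this ht
  have hdb : ∀ t, b < t → deriv χ t = 0 := by
    intro t ht
    have : χ =ᶠ[𝓝 t] fun _ => 0 := by
      filter_upwards [lt_mem_nhds ht] with s hs using hχb s hs.le
    rw [this.deriv_eq, deriv_const]
  set Q : Set (ℝ × (ℝ × ℝ)) :=
    Set.Ioc a b ×ˢ (Set.Ioo 0 (P.period 0) ×ˢ Set.Ioo 0 (P.period 1)) with hQ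
  have hsub : splitHeight ⁻¹' Q ⊆ P.cell := by
    intro x hx
    simp only [Set.mem_preimage, splitHeight_apply, hQ, Set.mem_prod] at hx
    exact ⟨hx.2.1, hx.2.2, (P.f_lt_h _).trans (ha.trans hx.1.1)⟩
  have h2 : ∫ x in splitHeight ⁻¹' Q, deriv χ (x 2) * (S x).im = 0 := by
    rw [← h1]
    refine (setIntegral_eq_of_subset_of_forall_sdiff_eq_zero measurableSet_cell hsub ?_).symm
    rintro x ⟨hxc, hxQ⟩
    have : deriv χ (x 2) = 0 := by
      by_contra hne
      refine hxQ ⟨⟨?_, ?_⟩, hxc.1, hxc.2.1⟩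
      · exact not_le.1 fun h => hne (hda _ h)
      · exact not_lt.1 fun h => hne (hdb _ h)
    rw [this, zero_mul]
  have h3 : ∫ z in Q, deriv χ z.1 * (S (point z.2 z.1)).im = 0 := by
    rw [← h2, ← measurePreserving_splitHeight.setIntegral_preimage_emb
      splitHeight.measurableEmbedding]
    simp only [splitHeight_apply, point_eta]
  have hbox : (volume.restrict (Set.Ioo 0 (P.period 0) ×ˢ Set.Ioo 0 (P.period 1))
      : Measure (ℝ × ℝ)) = volume.restrict P.box := by
    rw [box, Measure.volume_eq_prod, ← Measure.prod_restrict, ← Measure.prod_restrict,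
      restrict_Ioo_eq_restrict_Ioc, restrict_Ioo_eq_restrict_Ioc]
  have hgi : IntegrableOn (fun z : ℝ × (ℝ × ℝ) => deriv χ z.1 * (S (point z.2 z.1)).im) Q := by
    have hcont : ContinuousOn (fun z : ℝ × (ℝ × ℝ) => deriv χ z.1 * (S (point z.2 z.1)).im)
        (Set.Icc a b ×ˢ (Set.Icc 0 (P.period 0) ×ˢ Set.Icc 0 (P.period 1))) := by
      refine ((hχ.continuous_deriv (by simp)).comp continuous_fst).continuousOn.mul ?_
      refine Complex.continuous_im.comp_continuousOn ?_
      exact hScont.comp (continuous_point.comp continuous_swap).continuousOn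
        fun z hz => ha.trans_le hz.1.1
    refine (hcont.integrableOn_compact (isCompact_Icc.prod isCompact_closedBox)).mono_set ?_
    exact Set.prod_mono Set.Ioc_subset_Icc_self
      (Set.prod_mono Set.Ioo_subset_Icc_self Set.Ioo_subset_Icc_self)
  rw [hQ, Measure.volume_eq_prod] at h3 hgi
  rw [setIntegral_prod _ hgi] at h3
  rw [hbox] at h3
  simpa only [integral_const_mul] using h3

/-- If the imaginary part of the flux through horizontal planes is constant above height `h`, it
vanishes. -/
theorem flux_eq_zero (hu : P.IsH1Field u G)
    (hsol : ∀ w W, P.IsH1Field w W → (∃ H : ℝ, ∀ x, H ≤ x 2 → w x = 0) → P.form u G w W = 0)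
    (hreg : ∀ i, ContDiffOn ℝ 1 (fun x => u x i) P.domain) {C : ℝ}
    (hC : ∀ t, P.h < t → ∫ p in P.box,
      (P.fluxDensity u (fun i j => pd j (fun y => u y i)) (point p t)).im = C) : C = 0 := by
  set χ : ℝ → ℝ := fun t => Real.smoothTransition (P.h + 2 - t) with hχdef
  have hχ : ContDiff ℝ ∞ χ := Real.smoothTransition.contDiff.comp (contDiff_const.sub contDiff_id)
  have hχa : ∀ t, t ≤ P.h + 1 → χ t = 1 := fun t ht =>
    Real.smoothTransition.one_of_one_le (by linarith)
  have hχb : ∀ t, P.h + 2 ≤ t → χ t = 0 := fun t ht =>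
    Real.smoothTransition.zero_of_nonpos (by linarith)
  have h := integral_flux_eq_zero hu hsol hreg hχ (by linarith : P.h < P.h + 1) hχa hχb
  have h' : ∫ t in Set.Ioc (P.h + 1) (P.h + 2), deriv χ t * C = 0 := by
    rw [← h]
    refine setIntegral_congr_fun measurableSet_Ioc fun t ht => ?_
    simp only [hC t (by linarith [ht.1])]
  rw [integral_mul_const, ← intervalIntegral.integral_of_le (by linarith),
    intervalIntegral.integral_deriv_eq_sub
      (fun t _ => (hχ.differentiable (by simp)).differentiableAt)
      ((hχ.continuous_deriv (by simp)).intervalIntegrable _ _), hχa _ le_rfl, hχb _ le_rfl] at h'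
  linarith

/-! ### The Rayleigh expansion of the total field -/

/-- The vertical wave numbers of the `n`-th mode: a downward compressional, an upward compressional
and an upward shear wave. The first one occurs in the total field only for `n = 0`, where it
belongs to the incident wave. -/
def freq (P : Config) (n : Fin 2 → ℤ) : Fin 3 → ℂ :=
  ![-P.betaN P.kappa1 n, P.betaN P.kappa1 n, P.betaN P.kappa2 n]

/-- The vector amplitudes of the three waves in the `n`-th mode of the total field. -/
def amp (P : Config) (A B : (Fin 2 → ℤ) → Fin 3 → ℂ) (n : Fin 2 → ℤ) : Fin 3 → Fin 3 → ℂ :=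
  ![fun i => if n = 0 then (P.q i : ℂ) else 0, A n, B n]

/-- The wave vectors of the three waves in the `n`-th mode. -/
def modeVec (P : Config) (n : Fin 2 → ℤ) (l : Fin 3) : Fin 3 → ℂ := P.waveVec n (P.freq n l)

theorem modeVec_sq (n : Fin 2 → ℤ) (l : Fin 3) :
    dot (P.modeVec n l) (P.modeVec n l)
      = ![(P.kappa1 : ℂ) ^ 2, (P.kappa1 : ℂ) ^ 2, (P.kappa2 : ℂ) ^ 2] l := by
  have h1 := betaN_sq (P := P) (kappa1_pos (P := P)) n
  have h2 := betaN_sq (P := P) (kappa2_pos (P := P)) n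
  fin_cases l <;> simp only [dot, modeVec, waveVec, freq, Fin.zero_eta, Fin.mk_one, Fin.reduceFinMk,
    Matrix.cons_val]
  · linear_combination h1
  · linear_combination h1
  · linear_combination h2

theorem alphaN_zero (k : Fin 2) : P.alphaN 0 k = P.alpha k := by simp [alphaN]

theorem modeVec_zero (i : Fin 3) : P.modeVec 0 0 i = P.kappa1 * P.q i := by
  fin_cases i <;> simp [modeVec, waveVec, freq, alphaN_zero, alpha, q, betaN_zero, beta, mul_assoc]

theorem q_sq : (P.q 0 : ℂ) ^ 2 + (P.q 1 : ℂ) ^ 2 + (P.q 2 : ℂ) ^ 2 = 1 := by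
  have h : P.q 0 ^ 2 + P.q 1 ^ 2 + P.q 2 ^ 2 = 1 := by
    simp only [q, Matrix.cons_val]
    linear_combination Real.sin_sq_add_cos_sq P.theta1
      + Real.sin P.theta1 ^ 2 * Real.sin_sq_add_cos_sq P.theta2
  exact_mod_cast h

/-- Above height `h` the total field is the superposition of its modes. -/
theorem hasSum_totalField {u : Pt → Fin 3 → ℂ} {A B : (Fin 2 → ℤ) → Fin 3 → ℂ}
    (hrad : ∀ x : Pt, P.h < x 2 → ∀ i,
      HasSum (fun n =>
        A n i * Complex.exp (Complex.I * (P.alphaDot n (horiz x) + P.betaN P.kappa1 n * x 2))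
        + B n i * Complex.exp (Complex.I * (P.alphaDot n (horiz x) + P.betaN P.kappa2 n * x 2)))
        (u x i - P.uInc x i)) {t : ℝ} (ht : P.h < t) (i : Fin 3) (p : ℝ × ℝ) :
    HasSum (fun n => modeSum (P.freq n) (fun l => P.amp A B n l i) t * P.wave n p)
      (u (point p t) i) := by
  have h1 := hrad (point p t) ht i
  have h2 := hasSum_ite_eq (0 : Fin 2 → ℤ) (P.uInc (point p t) i)
  have h3 := h1.add h2
  rw [sub_add_cancel] at h3
  convert h3 using 2 with n
  have e : ∀ β : ℂ, Complex.exp (Complex.I * (P.alphaDot n (horiz (point p t))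
      + β * ((point p t 2 : ℝ) : ℂ))) = Complex.exp (Complex.I * β * t) * P.wave n p := by
    intro β
    rw [wave, ← Complex.exp_add]
    congr 1
    simp [alphaDot, horiz, point]
    ring
  rw [e, e]
  simp only [modeSum, Fin.sum_univ_three, amp, freq, Matrix.cons_val]
  split_ifs with hn
  · subst hn
    have : P.uInc (point p t) i
        = P.q i * (Complex.exp (Complex.I * -P.betaN P.kappa1 0 * t) * P.wave 0 p) := by
      rw [uInc, wave, ← Complex.exp_add, betaN_zero]
      congr 2
      simp [Fin.sum_univ_three, point, q, beta, alphaN_zero, alpha]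
      ring
    rw [this]; ring
  · ring

theorem period_mul_ne_zero : ((P.period 0 * P.period 1 : ℝ) : ℂ) ≠ 0 := by
  exact_mod_cast (mul_pos (P.period_pos 0) (P.period_pos 1)).ne'

/-- At the height `h` itself the modal expansion persists by continuity. -/
theorem HasModes.coef_h {n : Fin 2 → ℤ} {b c : Fin 3 → ℂ} {F : Pt → ℂ} {h₀ : ℝ}
    (hF : P.HasModes n b F c) (hreg : ContDiffOn ℝ 1 F (above h₀)) (h0 : h₀ < P.h) :
    P.coef F n P.h = (P.period 0 * P.period 1 : ℝ) * modeSum b c P.h := by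
  have h1 : Tendsto (P.coef F n) (𝓝[>] P.h) (𝓝 (P.coef F n P.h)) :=
    (hasDerivAt_coef hreg h0 n).continuousAt.mono_left nhdsWithin_le_nhds
  have h2 : Tendsto (fun t => (P.period 0 * P.period 1 : ℝ) * modeSum b c t) (𝓝[>] P.h)
      (𝓝 ((P.period 0 * P.period 1 : ℝ) * modeSum b c P.h)) :=
    ((hasDerivAt_modeSum b c P.h).continuousAt.const_mul _).mono_left nhdsWithin_le_nhds
  refine tendsto_nhds_unique h1 (h2.congr' ?_)
  filter_upwards [self_mem_nhdsWithin] with t ht using (hF t ht).symm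

theorem HasModes.fourierCoeffH {n : Fin 2 → ℤ} {b c : Fin 3 → ℂ} {F : Pt → ℂ} {h₀ : ℝ}
    (hF : P.HasModes n b F c) (hreg : ContDiffOn ℝ 1 F (above h₀)) (h0 : h₀ < P.h) :
    P.fourierCoeffH F n = modeSum b c P.h := by
  rw [fourierCoeffH_eq hreg.continuousOn h0, hF.coef_h hreg h0]
  have := period_mul_ne_zero (P := P)
  field_simp

/-! ### Polarization of the modes -/

/-- The modes of a field with Helmholtz potentials: the compressional amplitudes are longitudinal,
the shear amplitude is transversal, and the modes of the potentials follow from those of the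
field. -/
structure Polarized (P : Config) (φ : Pt → ℂ) (ψ : Pt → Fin 3 → ℂ) (n : Fin 2 → ℤ)
    (V : Fin 3 → Fin 3 → ℂ) : Prop where
  longitudinal : ∀ l : Fin 3, l ≠ 2 → ∀ i, V l i = ((P.kappa1 : ℂ) ^ 2)⁻¹
    * dot (P.modeVec n l) (V l) * P.modeVec n l i
  transversal : dot (P.modeVec n 2) (V 2) = 0
  modes_phi : P.HasModes n (P.freq n) φ fun l => -((P.kappa1 : ℂ) ^ 2)⁻¹ * (Complex.I
    * dot (P.modeVec n l) (V l))
  modes_psi : ∀ i, P.HasModes n (P.freq n) (fun x => ψ x i) fun l => ((P.kappa2 : ℂ) ^ 2)⁻¹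
    * (Complex.I * cross (P.modeVec n l) (V l) i)

theorem quasiPeriodic_qpOn {u : Pt → Fin 3 → ℂ} (hu : P.QuasiPeriodic u) (c : ℝ) (i : Fin 3) :
    P.QPOn c (fun x => u x i) := fun n x _ => by
  rw [add_latticeVec]; exact hu n x i

theorem kappa1_sq_ne_zero : (P.kappa1 : ℂ) ^ 2 ≠ 0 := by
  exact_mod_cast (pow_pos kappa1_pos 2).ne'

theorem kappa2_sq_ne_zero : (P.kappa2 : ℂ) ^ 2 ≠ 0 := by
  exact_mod_cast (pow_pos kappa2_pos 2).ne'

theorem kappa_sq_ne : (P.kappa1 : ℂ) ^ 2 ≠ (P.kappa2 : ℂ) ^ 2 := by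
  exact_mod_cast kappa1_sq_lt.ne

theorem betaN_ne (n : Fin 2 → ℤ) : P.betaN P.kappa1 n ≠ P.betaN P.kappa2 n := fun h => by
  have h1 := betaN_sq (P := P) (kappa1_pos (P := P)) n
  have h2 := betaN_sq (P := P) (kappa2_pos (P := P)) n
  rw [h, h2] at h1
  exact kappa_sq_ne (P := P) (by linear_combination -h1)

theorem above_h_subset_domain : above P.h ⊆ P.domain := fun _ hx => (P.f_lt_h _).trans hx

/-- The potentials are multiples of the divergence and the curl of `u`, so their modes follow from
those of `u`. Comparing the modes of the two sides of `u = ∇φ + ∇×ψ` then gives an algebraic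
equation for the amplitude of each upward wave. The downward wave, known explicitly, has to be
longitudinal to begin with; this makes it drop out of the comparison. -/
theorem polarized {u : Pt → Fin 3 → ℂ} {φ : Pt → ℂ} {ψ : Pt → Fin 3 → ℂ}
    (hp : P.IsHelmholtzPair u φ ψ) (hq : P.QuasiPeriodic u) {n : Fin 2 → ℤ}
    {V : Fin 3 → Fin 3 → ℂ}
    (hV : ∀ i, P.HasModes n (P.freq n) (fun x => u x i) fun l => V l i)
    (hV0 : ∀ i, V 0 i = ((P.kappa1 : ℂ) ^ 2)⁻¹ * dot (P.modeVec n 0) (V 0) * P.modeVec n 0 i) :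
    P.Polarized φ ψ n V := by
  have hsub := above_h_subset_domain (P := P)
  have hx := kappa1_sq_ne_zero (P := P)
  have hy := kappa2_sq_ne_zero (P := P)
  have hx' : (P.kappa1 : ℂ) ≠ 0 := by exact_mod_cast kappa1_pos.ne'
  have hy' : (P.kappa2 : ℂ) ≠ 0 := by exact_mod_cast kappa2_pos.ne'
  have uC : ∀ i, ContDiffOn ℝ 1 (fun x => u x i) (above P.h) := fun i =>
    (hp.contDiffOn_u i).mono hsub
  have uD : ∀ i, DifferentiableOn ℝ (fun x => u x i) (above P.h) := fun i =>
    (uC i).differentiableOn (by norm_num)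
  have uQ : ∀ i, P.QPOn P.h (fun x => u x i) := quasiPeriodic_qpOn hq P.h
  have duC : ∀ i j, ContinuousOn (pd j fun x => u x i) (above P.h) := fun i j =>
    continuousOn_pd_above (uC i) j
  have duQ : ∀ i j, P.QPOn P.h (pd j fun x => u x i) := fun i j => (uQ i).pd (uD i) j
  have duM : ∀ i j, P.HasModes n (P.freq n) (pd j fun x => u x i)
      fun l => Complex.I * P.modeVec n l j * V l i := fun i j => (hV i).pd (uC i) (uQ i) j
  -- the scalar potential
  have φC : ContDiffOn ℝ 1 φ (above P.h) := (hp.contDiff_phi.mono hsub).of_le (by norm_num)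
  have φe : ∀ x ∈ above P.h, φ x = -((P.kappa1 : ℂ) ^ 2)⁻¹
      * (pd 0 (fun y => u y 0) x + pd 1 (fun y => u y 1) x + pd 2 (fun y => u y 2) x) := by
    intro x hxm
    have h := hp.divergence_u (hsub hxm)
    rw [divergence, Fin.sum_univ_three] at h
    rw [h]; push_cast; field_simp [hx']
  have φQ : P.QPOn P.h φ :=
    ((((duQ 0 0).add (duQ 1 1)).add (duQ 2 2)).const_mul _).congr φe
  have φM : P.HasModes n (P.freq n) φ fun l => -((P.kappa1 : ℂ) ^ 2)⁻¹ * (Complex.I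
      * dot (P.modeVec n l) (V l)) := by
    have h := (((((duM 0 0).add (duM 1 1) (duC 0 0) (duC 1 1)).add (duM 2 2)
      ((duC 0 0).add (duC 1 1)) (duC 2 2))).const_mul (-((P.kappa1 : ℂ) ^ 2)⁻¹)).congr φe
    refine h.congr_amp fun l => ?_
    simp only [dot]
    ring
  -- the vector potential
  have ψC : ∀ i, ContDiffOn ℝ 1 (fun x => ψ x i) (above P.h) := fun i =>
    ((hp.contDiffOn_psi_apply i).mono hsub).of_le (by norm_num)
  have ψe : ∀ i, ∀ x ∈ above P.h, ψ x i = ((P.kappa2 : ℂ) ^ 2)⁻¹ * curl u x i := by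
    intro i x hxm
    rw [hp.curl_u (hsub hxm)]; push_cast; field_simp [hy']
  have curlQ : ∀ i, P.QPOn P.h (fun x => curl u x i) := by
    intro i
    fin_cases i
    · exact (duQ 2 1).sub (duQ 1 2)
    · exact (duQ 0 2).sub (duQ 2 0)
    · exact (duQ 1 0).sub (duQ 0 1)
  have ψQ : ∀ i, P.QPOn P.h (fun x => ψ x i) := fun i => ((curlQ i).const_mul _).congr (ψe i)
  have curlM : ∀ i, P.HasModes n (P.freq n) (fun x => curl u x i) fun l =>
      Complex.I * cross (P.modeVec n l) (V l) i := by
    intro i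
    fin_cases i
    · refine ((duM 2 1).sub (duM 1 2) (duC 2 1) (duC 1 2)).congr_amp fun l => ?_
      change _ * (_ - _) = _
      ring
    · refine ((duM 0 2).sub (duM 2 0) (duC 0 2) (duC 2 0)).congr_amp fun l => ?_
      change _ * (_ - _) = _
      ring
    · refine ((duM 1 0).sub (duM 0 1) (duC 1 0) (duC 0 1)).congr_amp fun l => ?_
      change _ * (_ - _) = _
      ring
  have ψM := fun i => ((curlM i).const_mul (((P.kappa2 : ℂ) ^ 2)⁻¹)).congr (ψe i)
  have dφC : ∀ j, ContinuousOn (pd j φ) (above P.h) := fun j => continuousOn_pd_above φC j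
  have dψC : ∀ i j, ContinuousOn (pd j fun x => ψ x i) (above P.h) := fun i j =>
    continuousOn_pd_above (ψC i) j
  have dφM := fun j => φM.pd φC φQ j
  have dψM := fun i j => (ψM i).pd (ψC i) (ψQ i) j
  -- both sides of `u = ∇φ + ∇×ψ` have the same modes
  have hR : ∀ i, ∀ t, P.h < t → modeSum (P.freq n) (fun l => V l i
      - (((P.kappa1 : ℂ) ^ 2)⁻¹ * (P.modeVec n l i * dot (P.modeVec n l) (V l))
        - ((P.kappa2 : ℂ) ^ 2)⁻¹ * (P.modeVec n l i * dot (P.modeVec n l) (V l)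
          - dot (P.modeVec n l) (P.modeVec n l) * V l i))) t = 0 := by
    intro i t ht
    have hue : ∀ x ∈ above P.h, u x i = pd i φ x + curl ψ x i := fun x hxm => by
      rw [hp.decomp x (hsub hxm)]; rfl
    rw [modeSum_sub, sub_eq_zero]
    refine mul_left_cancel₀ (period_mul_ne_zero (P := P)) ?_
    rw [← hV i t ht]
    fin_cases i
    · rw [((dφM 0).add ((dψM 2 1).sub (dψM 1 2) (dψC 2 1) (dψC 1 2)) (dφC 0)
        ((dψC 2 1).sub (dψC 1 2))).congr hue t ht]
      congr 2
      funext l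
      simp only [dot, cross, Fin.zero_eta, Matrix.cons_val]
      change _ * P.modeVec n l _ * _ + (_ * P.modeVec n l _ * _ - _ * P.modeVec n l _ * _) = _
      ring_nf
      simp only [Complex.I_sq]
      ring
    · rw [((dφM 1).add ((dψM 0 2).sub (dψM 2 0) (dψC 0 2) (dψC 2 0)) (dφC 1)
        ((dψC 0 2).sub (dψC 2 0))).congr hue t ht]
      congr 2
      funext l
      simp only [dot, cross, Fin.mk_one, Matrix.cons_val]
      change _ * P.modeVec n l _ * _ + (_ * P.modeVec n l _ * _ - _ * P.modeVec n l _ * _) = _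
      ring_nf
      simp only [Complex.I_sq]
      ring
    · rw [((dφM 2).add ((dψM 1 0).sub (dψM 0 1) (dψC 1 0) (dψC 0 1)) (dφC 2)
        ((dψC 1 0).sub (dψC 0 1))).congr hue t ht]
      congr 2
      funext l
      simp only [dot, cross, Fin.reduceFinMk, Matrix.cons_val]
      change _ * P.modeVec n l _ * _ + (_ * P.modeVec n l _ * _ - _ * P.modeVec n l _ * _) = _
      ring_nf
      simp only [Complex.I_sq]
      ring
  have hz := fun i => eq_zero_of_modeSum_eq_zero (b := P.freq n) (betaN_ne n) (by
    rw [modeVec_sq, Matrix.cons_val_zero]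
    have h := hV0 i
    generalize dot (P.modeVec n 0) (V 0) = s at h ⊢
    rw [h]
    field_simp
    ring) (hR i)
  refine ⟨fun l hl i => ?_, ?_, φM, ψM⟩
  · fin_cases l
    · exact hV0 i
    · exact longitudinal_of_eq hx hy kappa_sq_ne (modeVec_sq n 1)
        (fun i => sub_eq_zero.1 (hz i).1) i
    · exact absurd rfl hl
  · exact transversal_of_eq hx hy kappa_sq_ne (modeVec_sq n 2) (fun i => sub_eq_zero.1 (hz i).2)

/-! ### The flux of a mode and the Rayleigh coefficients -/

theorem norm_exp_freq {κ : ℝ} {n : Fin 2 → ℤ} (hn : n ∈ P.propagating κ) (t : ℝ) :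
    ‖Complex.exp (Complex.I * P.betaN κ n * t)‖ = 1 ∧
      ‖Complex.exp (Complex.I * -P.betaN κ n * t)‖ = 1 := by
  rw [← ofReal_re_betaN hn, Complex.norm_exp, Complex.norm_exp]
  simp

/-- The imaginary part of the flux of the `n`-th mode does not depend on the height, and only the
propagating waves contribute. -/
theorem im_flux_mode {φ : Pt → ℂ} {ψ : Pt → Fin 3 → ℂ} {n : Fin 2 → ℤ} {V : Fin 3 → Fin 3 → ℂ}
    (hpol : P.Polarized φ ψ n V) (hV0 : n ∉ P.propagating P.kappa1 → V 0 = 0) (t : ℝ) :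
    ((P.mu : ℂ) * (∑ i, modeSum (P.freq n) (fun l => Complex.I * P.modeVec n l 2 * V l i) t
          * star (modeSum (P.freq n) (fun l => V l i) t))
        + ((P.lam + P.mu : ℝ) : ℂ)
          * ((∑ i, modeSum (P.freq n) (fun l => Complex.I * P.modeVec n l i * V l i) t)
          * star (modeSum (P.freq n) (fun l => V l 2) t))).im
      = P.omega ^ 2 * ((P.betaN P.kappa1 n).re
          * (‖((P.kappa1 : ℂ) ^ 2)⁻¹ * dot (P.modeVec n 1) (V 1)‖ ^ 2
            - ‖((P.kappa1 : ℂ) ^ 2)⁻¹ * dot (P.modeVec n 0) (V 0)‖ ^ 2))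
        + P.mu * ((P.betaN P.kappa2 n).re * ∑ i, ‖V 2 i‖ ^ 2) := by
  have hl0 := hpol.longitudinal 0 (by decide)
  have hl1 := hpol.longitudinal 1 (by decide)
  have htr := hpol.transversal
  set c₀ := ((P.kappa1 : ℂ) ^ 2)⁻¹ * dot (P.modeVec n 0) (V 0) with hc₀
  set c₁ := ((P.kappa1 : ℂ) ^ 2)⁻¹ * dot (P.modeVec n 1) (V 1) with hc₁
  set b₁ := P.betaN P.kappa1 n with hb₁
  set b₂ := P.betaN P.kappa2 n with hb₂
  set E₀ := Complex.exp (Complex.I * -b₁ * t) with hE₀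
  set E₁ := Complex.exp (Complex.I * b₁ * t) with hE₁
  set E₂ := Complex.exp (Complex.I * b₂ * t) with hE₂
  have hw : (P.alphaN n 0 : ℂ) * (E₂ * V 2 0) + P.alphaN n 1 * (E₂ * V 2 1) + b₂ * (E₂ * V 2 2)
      = 0 := by
    simp only [dot, modeVec, waveVec, freq, Matrix.cons_val] at htr
    linear_combination E₂ * htr
  have hw' : (P.alphaN n 0 : ℂ) * star (E₂ * V 2 0) + P.alphaN n 1 * star (E₂ * V 2 1)
      + star b₂ * star (E₂ * V 2 2) = 0 := by
    have := congrArg star hw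
    simpa using this
  have hsq₁ : b₁ ^ 2 = (P.kappa1 : ℂ) ^ 2 - ((P.alphaN n 0 : ℂ) ^ 2 + (P.alphaN n 1 : ℂ) ^ 2) :=
    betaN_sq kappa1_pos n
  have hsq₂ : b₂ ^ 2 = (P.kappa2 : ℂ) ^ 2 - ((P.alphaN n 0 : ℂ) ^ 2 + (P.alphaN n 1 : ℂ) ^ 2) :=
    betaN_sq kappa2_pos n
  have hsq₂' : star b₂ ^ 2
      = (P.kappa2 : ℂ) ^ 2 - ((P.alphaN n 0 : ℂ) ^ 2 + (P.alphaN n 1 : ℂ) ^ 2) := by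
    have := congrArg star hsq₂
    simpa using this
  have hcase : star b₁ = b₁ ∨ (star b₁ = -b₁ ∧ c₀ * E₀ = 0 ∧ star (c₀ * E₀) = 0) := by
    by_cases hn : n ∈ P.propagating P.kappa1
    · exact Or.inl (star_betaN_of_mem hn)
    · have h0 : c₀ = 0 := by rw [hc₀, hV0 hn]; simp [dot]
      exact Or.inr ⟨star_betaN_of_notMem hn, by simp [h0], by simp [h0]⟩
  have hx : (P.kappa1 : ℂ) ^ 2 * (P.lam + 2 * P.mu) = (P.omega : ℂ) ^ 2 := by
    exact_mod_cast kappa1_sq (P := P)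
  have hy : (P.kappa2 : ℂ) ^ 2 * P.mu = (P.omega : ℂ) ^ 2 := by
    exact_mod_cast kappa2_sq (P := P)
  have key := flux_identity (a₀ := P.alphaN n 0) (a₁ := P.alphaN n 1) (p := c₀ * E₀)
    (p' := star (c₀ * E₀)) (r := c₁ * E₁) (r' := star (c₁ * E₁)) (w := fun i => E₂ * V 2 i)
    (w' := fun i => star (E₂ * V 2 i)) hsq₁ hsq₂ hsq₂' hcase hw hw' hx hy
  -- the first block of the identity is the flux divided by `i`, the second its conjugate
  set Q : ℂ := (P.mu : ℂ) * (∑ i, modeSum (P.freq n)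
        (fun l => Complex.I * P.modeVec n l 2 * V l i) t
          * star (modeSum (P.freq n) (fun l => V l i) t))
        + ((P.lam + P.mu : ℝ) : ℂ)
          * ((∑ i, modeSum (P.freq n) (fun l => Complex.I * P.modeVec n l i * V l i) t)
          * star (modeSum (P.freq n) (fun l => V l 2) t)) with hQ
  have f : ∀ l, P.freq n l = ![-b₁, b₁, b₂] l := fun l => rfl
  have m : ∀ l i, P.modeVec n l i = ![(P.alphaN n 0 : ℂ), P.alphaN n 1, ![-b₁, b₁, b₂] l] i :=
    fun l i => rfl
  have hu : ∀ i, modeSum (P.freq n) (fun l => V l i) t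
      = ![c₀ * E₀ * P.alphaN n 0 + c₁ * E₁ * P.alphaN n 0 + E₂ * V 2 0,
        c₀ * E₀ * P.alphaN n 1 + c₁ * E₁ * P.alphaN n 1 + E₂ * V 2 1,
        -(c₀ * E₀ * b₁) + c₁ * E₁ * b₁ + E₂ * V 2 2] i := by
    intro i
    simp only [modeSum, Fin.sum_univ_three, hl0, hl1, f, m, Matrix.cons_val, ← hE₀, ← hE₁, ← hE₂]
    fin_cases i <;> simp <;> ring
  have hdu : ∀ i, modeSum (P.freq n) (fun l => Complex.I * P.modeVec n l 2 * V l i) t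
      = Complex.I * ![-b₁ * (c₀ * E₀ * P.alphaN n 0) + b₁ * (c₁ * E₁ * P.alphaN n 0)
          + b₂ * (E₂ * V 2 0),
        -b₁ * (c₀ * E₀ * P.alphaN n 1) + b₁ * (c₁ * E₁ * P.alphaN n 1) + b₂ * (E₂ * V 2 1),
        b₁ * (c₀ * E₀ * b₁) + b₁ * (c₁ * E₁ * b₁) + b₂ * (E₂ * V 2 2)] i := by
    intro i
    simp only [modeSum, Fin.sum_univ_three, hl0, hl1, f, m, Matrix.cons_val, ← hE₀, ← hE₁, ← hE₂]
    fin_cases i <;> simp <;> ring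
  have hdiv : ∑ i, modeSum (P.freq n) (fun l => Complex.I * P.modeVec n l i * V l i) t
      = Complex.I * ((P.kappa1 : ℂ) ^ 2 * (c₀ * E₀ + c₁ * E₁)) := by
    have e0 : (P.kappa1 : ℂ) ^ 2 * c₀ = dot (P.modeVec n 0) (V 0) := by
      rw [hc₀, mul_inv_cancel_left₀ kappa1_sq_ne_zero]
    have e1 : (P.kappa1 : ℂ) ^ 2 * c₁ = dot (P.modeVec n 1) (V 1) := by
      rw [hc₁, mul_inv_cancel_left₀ kappa1_sq_ne_zero]
    simp only [dot] at e0 e1 htr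
    simp only [modeSum, Fin.sum_univ_three, f, Matrix.cons_val]
    linear_combination (-Complex.I * E₀) * e0 - Complex.I * E₁ * e1 + Complex.I * E₂ * htr
  have hsum : -Complex.I * Q + star (-Complex.I * Q) = (b₁ + star b₁) * (P.omega : ℂ) ^ 2
      * (c₁ * E₁ * star (c₁ * E₁) - c₀ * E₀ * star (c₀ * E₀))
      + P.mu * (b₂ + star b₂) * (E₂ * V 2 0 * star (E₂ * V 2 0) + E₂ * V 2 1 * star (E₂ * V 2 1)
        + E₂ * V 2 2 * star (E₂ * V 2 2)) := by
    rw [← key, hQ, hdiv]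
    simp only [hdu, hu, Fin.sum_univ_three, Matrix.cons_val]
    simp only [star_add, star_mul', star_neg, Complex.star_def, Complex.conj_I, Complex.conj_ofReal,
      Complex.conj_conj, map_pow, neg_neg]
    push_cast
    ring_nf
    simp only [Complex.I_sq]
    ring
  have hn1 : b₁.re * ‖E₁‖ ^ 2 = b₁.re ∧ b₁.re * ‖E₀‖ ^ 2 = b₁.re := by
    by_cases hn : n ∈ P.propagating P.kappa1
    · rw [hE₁, hE₀, (norm_exp_freq hn t).1, (norm_exp_freq hn t).2]; simp
    · rw [hb₁, re_betaN_of_notMem hn]; simp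
  have hn2 : b₂.re * ‖E₂‖ ^ 2 = b₂.re := by
    by_cases hn : n ∈ P.propagating P.kappa2
    · rw [hE₂, (norm_exp_freq hn t).1]; simp
    · rw [hb₂, re_betaN_of_notMem hn]; simp
  have hre := congrArg Complex.re hsum
  have hnorm : ∀ z : ℂ, z * star z = ((‖z‖ ^ 2 : ℝ) : ℂ) := fun z => by
    rw [Complex.star_def, Complex.mul_conj']; push_cast; rfl
  have hadd : ∀ z : ℂ, z + star z = ((2 * z.re : ℝ) : ℂ) := fun z => by
    rw [Complex.star_def, Complex.add_conj]
  simp only [hnorm, hadd, norm_mul] at hre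
  have hre' : 2 * Q.im = 2 * b₁.re * P.omega ^ 2
        * ((‖c₁‖ * ‖E₁‖) ^ 2 - (‖c₀‖ * ‖E₀‖) ^ 2)
      + P.mu * (2 * b₂.re) * ((‖E₂‖ * ‖V 2 0‖) ^ 2 + (‖E₂‖ * ‖V 2 1‖) ^ 2
        + (‖E₂‖ * ‖V 2 2‖) ^ 2) := by
    have hQi : (-Complex.I * Q).re = Q.im := by simp
    rw [hQi] at hre
    exact_mod_cast hre
  rw [Fin.sum_univ_three]
  linear_combination (1 / 2) * hre' + P.omega ^ 2 * ‖c₁‖ ^ 2 * hn1.1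
    - P.omega ^ 2 * ‖c₀‖ ^ 2 * hn1.2
    + P.mu * (‖V 2 0‖ ^ 2 + ‖V 2 1‖ ^ 2 + ‖V 2 2‖ ^ 2) * hn2

/-- The only mode of the incident potential is the downward compressional wave of index `0`. -/
theorem hasModes_phiInc (n : Fin 2 → ℤ) :
    P.HasModes n (P.freq n) P.phiInc ![if n = 0 then P.a0 else 0, 0, 0] := fun t _ => by
  have e : ∀ p, P.phiInc (point p t)
      = P.a0 * Complex.exp (Complex.I * -P.betaN P.kappa1 0 * t) * P.wave 0 p := by
    intro p
    rw [phiInc, wave, mul_assoc, ← Complex.exp_add, betaN_zero]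
    congr 2
    simp [point, alphaN_zero]
    ring
  simp only [coef, e, mul_assoc, integral_const_mul, integral_wave_mul_star_wave, modeSum,
    Fin.sum_univ_three, Matrix.cons_val, freq]
  by_cases hn : n = 0
  · subst hn; simp; ring
  · simp [hn, Ne.symm hn]

theorem contDiff_phiInc : ContDiff ℝ 1 P.phiInc := by
  have h : ∀ k : Fin 3, ContDiff ℝ 1 fun x : Pt => x k := fun k => contDiff_apply ℝ ℝ k
  unfold phiInc
  refine contDiff_const.mul (ContDiff.cexp (contDiff_const.mul ?_))
  exact Complex.ofRealCLM.contDiff.comp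
    (((contDiff_const.mul (h 0)).add (contDiff_const.mul (h 1))).sub (contDiff_const.mul (h 2)))

/-- The Rayleigh coefficient of the scalar potential in terms of the compressional amplitude. -/
theorem norm_a1 {u : Pt → Fin 3 → ℂ} {φ : Pt → ℂ} {ψ : Pt → Fin 3 → ℂ} {n : Fin 2 → ℤ}
    {V : Fin 3 → Fin 3 → ℂ} (hp : P.IsHelmholtzPair u φ ψ) (hpol : P.Polarized φ ψ n V)
    (hV0 : ∀ i, V 0 i = if n = 0 then (P.q i : ℂ) else 0) :
    ‖P.a1 φ n‖ = ‖((P.kappa1 : ℂ) ^ 2)⁻¹ * dot (P.modeVec n 1) (V 1)‖ := by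
  obtain ⟨h₀, h0, hsub⟩ := exists_lt_h (P := P)
  have hφ : ContDiffOn ℝ 1 φ (above h₀) := (hp.contDiff_phi.mono hsub).of_le (by norm_num)
  have hinc : ContDiffOn ℝ 1 P.phiInc (above h₀) := contDiff_phiInc.contDiffOn
  have hle : above P.h ⊆ above h₀ := fun x hx => h0.trans hx
  have hm := hpol.modes_phi.sub (hasModes_phiInc n) (hφ.continuousOn.mono hle)
    (hinc.continuousOn.mono hle)
  have hx : (P.kappa1 : ℂ) ≠ 0 := by exact_mod_cast kappa1_pos.ne'
  have hinc0 : -((P.kappa1 : ℂ) ^ 2)⁻¹ * (Complex.I * dot (P.modeVec n 0) (V 0))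
      - (if n = 0 then P.a0 else 0) = 0 := by
    by_cases hn : n = 0
    · subst hn
      have : dot (P.modeVec 0 0) (V 0) = P.kappa1 := by
        simp only [dot, modeVec_zero, hV0, if_true]
        linear_combination (P.kappa1 : ℂ) * q_sq (P := P)
      rw [this, if_pos rfl, a0]
      field_simp
      ring
    · simp [dot, hV0, hn]
  rw [a1, hm.fourierCoeffH (hφ.sub hinc) h0]
  simp only [modeSum, Fin.sum_univ_three, Matrix.cons_val, hinc0, hpol.transversal, freq, zero_mul,
    mul_zero, sub_zero, add_zero, zero_add]
  rw [mul_assoc, ← Complex.exp_add]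
  have : Complex.I * P.betaN P.kappa1 n * P.h + -Complex.I * P.betaN P.kappa1 n * P.h = 0 := by ring
  rw [this, Complex.exp_zero, mul_one]
  simp

/-- The Rayleigh coefficient of the vector potential in terms of the shear amplitude. -/
theorem b_eq {u : Pt → Fin 3 → ℂ} {φ : Pt → ℂ} {ψ : Pt → Fin 3 → ℂ} {n : Fin 2 → ℤ}
    {V : Fin 3 → Fin 3 → ℂ} (hp : P.IsHelmholtzPair u φ ψ) (hpol : P.Polarized φ ψ n V)
    (i : Fin 3) :
    P.b ψ n i = ((P.kappa2 : ℂ) ^ 2)⁻¹ * (Complex.I * cross (P.modeVec n 2) (V 2) i) := by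
  obtain ⟨h₀, h0, hsub⟩ := exists_lt_h (P := P)
  have hψ : ContDiffOn ℝ 1 (fun x => ψ x i) (above h₀) :=
    ((hp.contDiffOn_psi_apply i).mono hsub).of_le (by norm_num)
  have hl : ∀ l : Fin 3, l ≠ 2 → cross (P.modeVec n l) (V l) i = 0 := by
    intro l hl
    have h := hpol.longitudinal l hl
    generalize ((P.kappa1 : ℂ) ^ 2)⁻¹ * dot (P.modeVec n l) (V l) = c at h
    fin_cases i <;> simp [cross, h] <;> ring
  rw [b, (hpol.modes_psi i).fourierCoeffH hψ h0]
  simp only [modeSum, Fin.sum_univ_three, hl 0 (by decide), hl 1 (by decide), freq,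
    Matrix.cons_val, zero_mul, mul_zero, zero_add]
  rw [mul_assoc _ _ (Complex.exp _), ← Complex.exp_add]
  have : Complex.I * P.betaN P.kappa2 n * P.h + -Complex.I * P.betaN P.kappa2 n * P.h = 0 := by ring
  rw [this, Complex.exp_zero, mul_one]

/-- The flux of the shear wave in terms of the Rayleigh coefficient of the vector potential. For a
propagating wave the wave vector is real, so `‖k × v‖² = κ₂² ‖v‖²` when `k·v = 0`; an evanescent
wave contributes `0` to both sides. -/
theorem mu_mul_re_betaN {u : Pt → Fin 3 → ℂ} {φ : Pt → ℂ} {ψ : Pt → Fin 3 → ℂ} {n : Fin 2 → ℤ}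
    {V : Fin 3 → Fin 3 → ℂ} (hp : P.IsHelmholtzPair u φ ψ) (hpol : P.Polarized φ ψ n V) :
    P.mu * ((P.betaN P.kappa2 n).re * ∑ i, ‖V 2 i‖ ^ 2)
      = P.omega ^ 2 * ((P.betaN P.kappa2 n).re * ∑ i, ‖P.b ψ n i‖ ^ 2) := by
  by_cases hn : n ∈ P.propagating P.kappa2
  · have hstar : ∀ i, star (P.modeVec n 2 i) = P.modeVec n 2 i := by
      intro i
      have := star_betaN_of_mem hn
      fin_cases i <;> simp_all [modeVec, waveVec, freq]
    have hcs : ∀ i, star (cross (P.modeVec n 2) (V 2) i)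
        = cross (P.modeVec n 2) (fun j => star (V 2 j)) i := by
      intro i
      fin_cases i <;> simp only [cross, Fin.zero_eta, Fin.mk_one, Fin.reduceFinMk, Matrix.cons_val,
        star_sub, star_mul', hstar]
    have hcc := dot_cross_cross (v' := fun j => star (V 2 j)) hpol.transversal
    rw [modeVec_sq] at hcc
    have hnorm : ∀ z : ℂ, ((‖z‖ ^ 2 : ℝ) : ℂ) = z * star z := fun z => by
      rw [Complex.star_def, Complex.mul_conj']; push_cast; rfl
    have hb : ((∑ i, ‖P.b ψ n i‖ ^ 2 : ℝ) : ℂ)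
        = ((P.kappa2 : ℂ) ^ 2)⁻¹ * ((∑ i, ‖V 2 i‖ ^ 2 : ℝ) : ℂ) := by
      have hy := kappa2_sq_ne_zero (P := P)
      have hy' : (P.kappa2 : ℂ) ≠ 0 := by exact_mod_cast kappa2_pos.ne'
      rw [Complex.ofReal_sum, Complex.ofReal_sum]
      simp only [hnorm, b_eq hp hpol, star_mul', hcs, Fin.sum_univ_three]
      simp only [dot, Matrix.cons_val] at hcc
      have h1 : star (((P.kappa2 : ℂ) ^ 2)⁻¹) = ((P.kappa2 : ℂ) ^ 2)⁻¹ := by simp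
      have h2 : star Complex.I = -Complex.I := Complex.conj_I
      rw [h1, h2]
      have h3 : ((P.kappa2 : ℂ) ^ 2)⁻¹ * (P.kappa2 : ℂ) ^ 2 = 1 := inv_mul_cancel₀ hy
      linear_combination (((P.kappa2 : ℂ) ^ 2)⁻¹) ^ 2 * hcc
        - (((P.kappa2 : ℂ) ^ 2)⁻¹) ^ 2
          * (cross (P.modeVec n 2) (V 2) 0 * cross (P.modeVec n 2) (fun j => star (V 2 j)) 0
            + cross (P.modeVec n 2) (V 2) 1 * cross (P.modeVec n 2) (fun j => star (V 2 j)) 1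
            + cross (P.modeVec n 2) (V 2) 2 * cross (P.modeVec n 2) (fun j => star (V 2 j)) 2)
          * Complex.I_sq
        + ((P.kappa2 : ℂ) ^ 2)⁻¹
          * (V 2 0 * star (V 2 0) + V 2 1 * star (V 2 1) + V 2 2 * star (V 2 2)) * h3
    have hb' : ∑ i, ‖P.b ψ n i‖ ^ 2 = (P.kappa2 ^ 2)⁻¹ * ∑ i, ‖V 2 i‖ ^ 2 := by exact_mod_cast hb
    have hk := kappa2_pos (P := P)
    rw [hb', ← kappa2_sq]
    field_simp
  · rw [re_betaN_of_notMem hn]; simp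

/-! ### Energy balance -/

/-- The energy balance between the incident and the scattered propagating waves. -/
theorem hasSum_energy {u : Pt → Fin 3 → ℂ} {φ : Pt → ℂ} {ψ : Pt → Fin 3 → ℂ}
    (hu : P.IsTotalField u) (hp : P.IsHelmholtzPair u φ ψ) :
    HasSum (fun n => (P.betaN P.kappa1 n).re * (‖P.a1 φ n‖ ^ 2 - if n = 0 then ‖P.a0‖ ^ 2 else 0)
      + (P.betaN P.kappa2 n).re * ∑ i, ‖P.b ψ n i‖ ^ 2) 0 := by
  obtain ⟨⟨G, hG, hsol⟩, A, B, hrad⟩ := hu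
  have hsub := above_h_subset_domain (P := P)
  have uC : ∀ i, ContDiffOn ℝ 1 (fun x => u x i) (above P.h) := fun i =>
    (hp.contDiffOn_u i).mono hsub
  have hS := fun {t : ℝ} (ht : P.h < t) => hasSum_totalField hrad ht
  have hM : ∀ n i, P.HasModes n (P.freq n) (fun x => u x i) fun l => P.amp A B n l i :=
    fun n i t ht => integral_mul_star_wave (hS ht i) n
  have hdM : ∀ n i j, P.HasModes n (P.freq n) (pd j fun x => u x i)
      fun l => Complex.I * P.modeVec n l j * P.amp A B n l i := fun n i j =>
    (hM n i).pd (uC i) (quasiPeriodic_qpOn hG.quasiPeriodic P.h i) j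
  have hx : (P.kappa1 : ℂ) ≠ 0 := by exact_mod_cast kappa1_pos.ne'
  have hV0 : ∀ n i, P.amp A B n 0 i = if n = 0 then (P.q i : ℂ) else 0 := fun n i => rfl
  have hs0 : dot (P.modeVec 0 0) (P.amp A B 0 0) = P.kappa1 := by
    simp only [dot, modeVec_zero, hV0, if_true]
    linear_combination (P.kappa1 : ℂ) * q_sq (P := P)
  have hpol : ∀ n, P.Polarized φ ψ n (P.amp A B n) := fun n =>
    polarized hp hG.quasiPeriodic (hM n) fun i => by
      by_cases hn : n = 0
      · subst hn
        rw [hs0, modeVec_zero, hV0, if_pos rfl]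
        field_simp
      · simp [dot, hV0, hn]
  have hc0 : ∀ n, ‖((P.kappa1 : ℂ) ^ 2)⁻¹ * dot (P.modeVec n 0) (P.amp A B n 0)‖ ^ 2
      = if n = 0 then ‖P.a0‖ ^ 2 else 0 := by
    intro n
    by_cases hn : n = 0
    · subst hn
      rw [hs0, if_pos rfl, a0]
      congr 1
      rw [norm_mul, norm_div, norm_neg, Complex.norm_I, norm_inv, norm_pow]
      have : ‖(P.kappa1 : ℂ)‖ ≠ 0 := norm_ne_zero_iff.2 hx
      field_simp
    · simp [dot, hV0, hn]
  set c : (Fin 2 → ℤ) → ℝ := fun n =>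
    (P.betaN P.kappa1 n).re * (‖P.a1 φ n‖ ^ 2 - if n = 0 then ‖P.a0‖ ^ 2 else 0)
      + (P.betaN P.kappa2 n).re * ∑ i, ‖P.b ψ n i‖ ^ 2 with hc
  set Λ : ℝ := P.period 0 * P.period 1 with hΛ
  have hΛ0 : 0 < Λ := mul_pos (P.period_pos 0) (P.period_pos 1)
  have hpos : 0 < Λ * P.omega ^ 2 := mul_pos hΛ0 (pow_pos P.omega_pos 2)
  -- Parseval's relation for the flux through the plane of height `t`
  have hflux : ∀ t, P.h < t → HasSum (fun n => Λ * P.omega ^ 2 * c n) (∫ p in P.box,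
      (P.fluxDensity u (fun i j => pd j (fun y => u y i)) (point p t)).im) := by
    intro t ht
    have cu : ∀ i, Continuous fun p => u (point p t) i := fun i =>
      continuous_comp_point (uC i).continuousOn ht
    have cdu : ∀ i j, Continuous fun p => pd j (fun y => u y i) (point p t) := fun i j =>
      continuous_comp_point (continuousOn_pd_above (uC i) j) ht
    have cdiv : Continuous fun p => ∑ i, pd i (fun y => u y i) (point p t) :=
      continuous_finsetSum _ fun i _ => cdu i i
    have s1 : ∀ i, HasSum (fun n => Λ * modeSum (P.freq n)
          (fun l => Complex.I * P.modeVec n l 2 * P.amp A B n l i) t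
          * star (modeSum (P.freq n) (fun l => P.amp A B n l i) t))
        (∫ p in P.box, pd 2 (fun y => u y i) (point p t) * star (u (point p t) i)) := by
      intro i
      have h := hasSum_integral_mul_star (cdu i 2) (hS ht i)
      refine h.congr_fun fun n => ?_
      rw [← hdM n i 2 t ht]; rfl
    have s2 : HasSum (fun n => Λ * (∑ i, modeSum (P.freq n)
          (fun l => Complex.I * P.modeVec n l i * P.amp A B n l i) t)
          * star (modeSum (P.freq n) (fun l => P.amp A B n l 2) t))
        (∫ p in P.box, (∑ i, pd i (fun y => u y i) (point p t)) * star (u (point p t) 2)) := by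
      have h := hasSum_integral_mul_star cdiv (hS ht 2)
      refine h.congr_fun fun n => ?_
      congr 1
      simp only [Finset.sum_mul, Finset.mul_sum]
      refine Eq.trans (Finset.sum_congr rfl fun i _ => (hdM n i i t ht).symm) ?_
      exact (integral_finsetSum _ fun i _ =>
        integrableOn_coef (continuousOn_pd_above (uC i) i) ht n).symm
    have hi1 : ∀ i, IntegrableOn
        (fun p => pd 2 (fun y => u y i) (point p t) * star (u (point p t) i)) P.box :=
      fun i => integrableOn_box ((cdu i 2).mul (cu i).star)
    have hi1' : IntegrableOn
        (fun p => ∑ i, pd 2 (fun y => u y i) (point p t) * star (u (point p t) i)) P.box :=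
      integrable_finsetSum _ fun i _ => hi1 i
    have hi2 : IntegrableOn
        (fun p => (∑ i, pd i (fun y => u y i) (point p t)) * star (u (point p t) 2)) P.box :=
      integrableOn_box (cdiv.mul (cu 2).star)
    have h := ((hasSum_sum fun i (_ : i ∈ Finset.univ) => s1 i).mul_left (P.mu : ℂ)).add
      (s2.mul_left ((P.lam + P.mu : ℝ) : ℂ))
    have him := Complex.hasSum_im h
    rw [← integral_finsetSum _ fun i _ => hi1 i, ← integral_const_mul, ← integral_const_mul,
      ← integral_add (hi1'.const_mul _) (hi2.const_mul _)] at him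
    have hval : ∫ p in P.box, (P.fluxDensity u (fun i j => pd j (fun y => u y i)) (point p t)).im
        = (∫ p in P.box, P.fluxDensity u (fun i j => pd j (fun y => u y i)) (point p t)).im :=
      integral_im ((hi1'.const_mul (P.mu : ℂ)).add (hi2.const_mul ((P.lam + P.mu : ℝ) : ℂ)))
    rw [hval]
    refine HasSum.congr_fun him fun n => ?_
    have hmode := im_flux_mode (hpol n) (fun hn => funext fun i => by
      rw [hV0, if_neg fun h0 : n = 0 => hn (h0 ▸ zero_mem_propagating)]; rfl) t
    rw [mu_mul_re_betaN hp (hpol n), hc0, ← norm_a1 hp (hpol n) (hV0 n), ← mul_add] at hmode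
    rw [mul_assoc, hc, ← hmode, ← Complex.im_ofReal_mul]
    congr 1
    simp only [Fin.sum_univ_three]
    ring
  have hC : ∀ t, P.h < t → ∫ p in P.box,
      (P.fluxDensity u (fun i j => pd j (fun y => u y i)) (point p t)).im
      = ∑' n, Λ * P.omega ^ 2 * c n := fun t ht => (hflux t ht).tsum_eq.symm
  have hzero := flux_eq_zero hG hsol hp.contDiffOn_u hC
  have h1 := hflux (P.h + 1) (by linarith)
  rw [hC _ (by linarith), hzero] at h1
  -- the constant flux vanishes, and it is the sum of the series up to the factor `Λ ω²`
  have h2 := h1.mul_left (Λ * P.omega ^ 2)⁻¹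
  rw [mul_zero] at h2
  exact h2.congr_fun fun n => (inv_mul_cancel_left₀ hpos.ne' _).symm

/-- The energy balance as an identity between finite sums over the propagating modes. -/
theorem sum_energy {u : Pt → Fin 3 → ℂ} {φ : Pt → ℂ} {ψ : Pt → Fin 3 → ℂ}
    (hu : P.IsTotalField u) (hp : P.IsHelmholtzPair u φ ψ) :
    ∑ n ∈ (finite_propagating P P.kappa1).toFinset, (P.betaN P.kappa1 n).re * ‖P.a1 φ n‖ ^ 2
      + ∑ n ∈ (finite_propagating P P.kappa2).toFinset,
        (P.betaN P.kappa2 n).re * ∑ i, ‖P.b ψ n i‖ ^ 2 = P.beta * ‖P.a0‖ ^ 2 := by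
  have h1 : HasSum (fun n => (P.betaN P.kappa1 n).re * ‖P.a1 φ n‖ ^ 2)
      (∑ n ∈ (finite_propagating P P.kappa1).toFinset,
        (P.betaN P.kappa1 n).re * ‖P.a1 φ n‖ ^ 2) :=
    hasSum_sum_of_ne_finset_zero fun n hn => by
      rw [re_betaN_of_notMem (by simpa using hn), zero_mul]
  have h2 : HasSum (fun n => (P.betaN P.kappa2 n).re * ∑ i, ‖P.b ψ n i‖ ^ 2)
      (∑ n ∈ (finite_propagating P P.kappa2).toFinset,
        (P.betaN P.kappa2 n).re * ∑ i, ‖P.b ψ n i‖ ^ 2) :=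
    hasSum_sum_of_ne_finset_zero fun n hn => by
      rw [re_betaN_of_notMem (by simpa using hn), zero_mul]
  have h0 := hasSum_ite_eq (0 : Fin 2 → ℤ) (P.beta * ‖P.a0‖ ^ 2)
  have h := (((h1.sub h0).add h2).congr_fun fun n => ?_).unique (hasSum_energy hu hp)
  · linarith
  · by_cases hn : n = 0
    · subst hn
      simp only [if_true, betaN_zero, Complex.ofReal_re]
      ring
    · simp only [if_neg hn, sub_zero]

/-- The energy balance, divided by the energy flux of the incident wave. -/
theorem sum_efficiencies {u : Pt → Fin 3 → ℂ} {φ : Pt → ℂ} {ψ : Pt → Fin 3 → ℂ}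
    (hu : P.IsTotalField u) (hp : P.IsHelmholtzPair u φ ψ) :
    (∑ᶠ n ∈ P.propagating P.kappa1, P.e1 φ n)
      + (∑ᶠ n ∈ P.propagating P.kappa2, P.e2 ψ n) = 1 := by
  have hf1 := finite_propagating P P.kappa1
  have hf2 := finite_propagating P P.kappa2
  have hd : P.beta * ‖P.a0‖ ^ 2 ≠ 0 := by
    have ha : P.a0 ≠ 0 := div_ne_zero (neg_ne_zero.2 Complex.I_ne_zero)
      (by exact_mod_cast kappa1_pos.ne')
    exact mul_ne_zero beta_pos.ne' (pow_ne_zero 2 (norm_ne_zero_iff.2 ha))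
  rw [finsum_mem_eq_finite_toFinset_sum _ hf1, finsum_mem_eq_finite_toFinset_sum _ hf2]
  have h1 : ∑ n ∈ hf1.toFinset, P.e1 φ n = ((∑ n ∈ hf1.toFinset,
      (P.betaN P.kappa1 n).re * ‖P.a1 φ n‖ ^ 2 : ℝ) : ℂ) / (P.beta * ‖P.a0‖ ^ 2 : ℝ) := by
    rw [Complex.ofReal_sum, Finset.sum_div]
    refine Finset.sum_congr rfl fun n hn => ?_
    rw [e1, Complex.ofReal_mul (P.betaN P.kappa1 n).re, ofReal_re_betaN (by simpa using hn)]
  have h2 : ∑ n ∈ hf2.toFinset, P.e2 ψ n = ((∑ n ∈ hf2.toFinset,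
      (P.betaN P.kappa2 n).re * ∑ i, ‖P.b ψ n i‖ ^ 2 : ℝ) : ℂ) / (P.beta * ‖P.a0‖ ^ 2 : ℝ) := by
    rw [Complex.ofReal_sum, Finset.sum_div]
    refine Finset.sum_congr rfl fun n hn => ?_
    rw [e2, Complex.ofReal_mul (P.betaN P.kappa2 n).re, ofReal_re_betaN (by simpa using hn)]
  rw [h1, h2, ← add_div, ← Complex.ofReal_add, sum_energy hu hp,
    div_self (Complex.ofReal_ne_zero.2 hd)]

end Config

end ElasticGrating

end

/-- Energy conservation for the elastic grating problem: the efficiencies of the finitely many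
propagating compressional and shear modes sum to `1`. -/
theorem theorem2p1 (P : ElasticGrating.Config) (hP : P.NonResonant)
    (u : ElasticGrating.Pt → Fin 3 → ℂ) (hu : P.IsTotalField u)
    (φt : ElasticGrating.Pt → ℂ) (ψt : ElasticGrating.Pt → Fin 3 → ℂ)
    (hpot : P.IsHelmholtzPair u φt ψt) :
    (P.propagating P.kappa1).Finite ∧ (P.propagating P.kappa2).Finite ∧
      (∑ᶠ n ∈ P.propagating P.kappa1, P.e1 φt n)
        + (∑ᶠ n ∈ P.propagating P.kappa2, P.e2 ψt n) = 1 := by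
  exact ⟨ElasticGrating.Config.finite_propagating P P.kappa1,
    ElasticGrating.Config.finite_propagating P P.kappa2,
    ElasticGrating.Config.sum_efficiencies hu hpot⟩
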